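/- Let $(R,\mathfrak m,k)$ be a one-dimensional Noetherian local domain with infinite residue field $k$ and fraction field $K$. Assume that the integral closure $\overline R$ of $R$ in $K$ is a finite $R$-module and a discrete valuation ring, and that $R$ is residually rational, i.e. the natural map from $k$ to the residue field of $\overline R$ is an isomorphism. For $R$-submodules $M,N\subseteq K$ put $M:N=\{y\in K\mid yN\subseteq M\}$, and let $\ell$ denote length over $R$. Let $\omega$ be a canonical module of $R$, chosen so that $R\subseteq\omega\subseteq\overline R$. Let $I$ be an $\mathfrak m$-primary ideal of $R$ that is not principal, and let $\Lambda=\bigcup_{n\ge 0}(I^n:I^n)$ be the blowing-up of $R$ along $I$. Let $h_I(z)\in\mathbb Z[z]$ be the polynomial with $\sum_{n\ge0}\ell(I^n/I^{n+1})z^n=h_I(z)/(1-z)$, and let $e=h_I(1)$ and $\rho=h_I'(1)$ be the multiplicity and the genus of $I$. Let $x\in I$ be a minimal reduction of $I$, i.e. $I^{n+1}=xI^n$ for all $n\gg0$, and let $\nu$ be the least integer such that $I^{n+1}=xI^n$ for all $n\ge\nu$. Put $\delta=\ell(\overline R/R)$, $c=\ell(\overline R/(R:\overline R))$ and $c_\Lambda=\ell(\overline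 R/(\Lambda:\overline R))$. All these lengths are finite, $h_I$ exists, $I^\nu\subseteq R:\Lambda$, $\Lambda\subseteq\omega\Lambda$, the lengths $\ell((R:\Lambda)/I^\nu)$ and $\ell(\omega\Lambda/\Lambda)$ are finite, and: 1. $2\rho=e\nu+(2\delta-c)-\ell\big((R:\Lambda)/I^{\nu}\big)-\ell(\omega\Lambda/\Lambda)$; in particular $2\rho\le e\nu+(2\delta-c)$. 2. The following are equivalent: (a) $2\rho=e\nu+(2\delta-c)$; (b) $\Lambda$ is Gorenstein and $c-c_\Lambda=e\nu$; (c) $R:\Lambda=I^\nu$ and $\omega\Lambda=\Lambda$; (d) $R:\Lambda=I^\nu\subseteq R:\omega$. -/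

import Mathlib

universe u

open CategoryTheory

noncomputable section

namespace BlowUp

section Homological

/-- A finitely generated module `M` over a Noetherian local ring `(A, 𝔪, k)` of Krull dimension `d`
is a canonical module if `Ext^i_A(k, M) = 0` for `i ≠ d` and `Ext^d_A(k, M) ≅ k`. -/
structure IsCanonicalModule (A : Type u) [CommRing A] [IsLocalRing A] (d : ℕ)
    (M : Type u) [AddCommGroup M] [Module A M] : Prop where
  finite : Module.Finite A M
  dim_eq : ringKrullDim A = d
  ext_eq_zero : ∀ i : ℕ, i ≠ d → Subsingleton
    (Abelian.Ext (ModuleCat.of A (IsLocalRing.ResidueField A)) (ModuleCat.of A M) i)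
  ext_equiv : Nonempty
    (Abelian.Ext (ModuleCat.of A (IsLocalRing.ResidueField A)) (ModuleCat.of A M) d
      ≃ₗ[A] IsLocalRing.ResidueField A)

/-- A Gorenstein local ring: a Noetherian local ring of finite injective dimension over itself. -/
structure IsGorensteinLocalRing (A : Type u) [CommRing A] : Prop where
  isLocalRing : IsLocalRing A
  isNoetherianRing : IsNoetherianRing A
  finite_injectiveDimension : ∃ n : ℕ, HasInjectiveDimensionLT (ModuleCat.of A A) n

end Homological

section Ring

variable {R : Type u} [CommRing R]

/-- The length of the `R`-module `I^n / I^(n+1)`. -/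
def hilbertLength (I : Ideal R) (n : ℕ) : ℕ∞ :=
  Module.length R (↥(I ^ n) ⧸ (I ^ (n + 1)).submoduleOf (I ^ n))

/-- The Hilbert–Poincaré series `∑ ℓ(I^n / I^(n+1)) z^n`. -/
def hilbertSeries (I : Ideal R) : PowerSeries ℤ :=
  PowerSeries.mk fun n => ((hilbertLength I n).toNat : ℤ)

/-- `h` is the numerator of the Hilbert–Poincaré series over the denominator `1 - z`. -/
def IsHPolynomial (I : Ideal R) (h : Polynomial ℤ) : Prop :=
  (h : PowerSeries ℤ) = (1 - PowerSeries.X) * hilbertSeries I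

open Classical in
/-- The `h`-polynomial of `I` (and `0` if the series is not of the form `h(z) / (1 - z)`). -/
def hPolynomial (I : Ideal R) : Polynomial ℤ :=
  if H : ∃ h, IsHPolynomial I h then H.choose else 0

/-- The multiplicity `e(I) = h_I(1)`. -/
def multiplicity (I : Ideal R) : ℤ := (hPolynomial I).eval 1

/-- The genus `ρ(I) = h_I'(1)`. -/
def genus (I : Ideal R) : ℤ := (Polynomial.derivative (hPolynomial I)).eval 1

/-- `x ∈ I` is a minimal reduction of `I`: `I^(n+1) = x I^n` for `n ≫ 0`. -/
def IsMinimalReduction (I : Ideal R) (x : R) : Prop :=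
  x ∈ I ∧ ∃ N : ℕ, ∀ n ≥ N, I ^ (n + 1) = Ideal.span {x} * I ^ n

/-- The reduction exponent `ν`: the least integer such that `I^(n+1) = x I^n` for all `n ≥ ν`. -/
def reductionExponent (I : Ideal R) (x : R) : ℕ :=
  sInf {m : ℕ | ∀ n ≥ m, I ^ (n + 1) = Ideal.span {x} * I ^ n}

end Ring

section Fractional

variable {R : Type u} [CommRing R] {K : Type u} [Field K] [Algebra R K]

/-- The length of the `R`-module `M / N`, for `R`-submodules `N ⊆ M` of `K`. -/
def quotLength (M N : Submodule R K) : ℕ∞ :=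
  Module.length R (↥M ⧸ N.submoduleOf M)

variable (K) in
/-- The power `I^n`, as an `R`-submodule of `K`. -/
def idealPow (I : Ideal R) (n : ℕ) : Submodule R K :=
  IsLocalization.coeSubmodule K (I ^ n)

theorem div_idealPow_mono (I : Ideal R) :
    Monotone fun n => idealPow K I n / idealPow K I n := by
  refine monotone_nat_of_le_succ fun n x hx => ?_
  simp only [Submodule.mem_div_iff_forall_mul_mem] at hx ⊢
  have e : idealPow K I (n + 1) = idealPow K I n * idealPow K I 1 := by
    simp [idealPow, pow_succ, IsLocalization.coeSubmodule_mul]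
  intro y hy
  rw [e] at hy ⊢
  induction hy using Submodule.mul_induction_on' with
  | mem_mul_mem a ha b hb =>
    rw [← mul_assoc]
    exact Submodule.mul_mem_mul (hx a ha) hb
  | add a _ b _ ha hb =>
    rw [mul_add]
    exact add_mem ha hb

variable (K) in
/-- The blowing-up `Λ(I) = ⋃ₙ (I^n : I^n)` of `R` along `I`, a subring of `K` containing `R`.
Here `M / N` is Mathlib's notation for the colon `M : N = {x ∈ K | x N ⊆ M}`. -/
def blowup (I : Ideal R) : Subalgebra R K where
  carrier := ⋃ n : ℕ, ((idealPow K I n / idealPow K I n : Submodule R K) : Set K)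
  mul_mem' := by
    intro a b ha hb
    obtain ⟨m, hm⟩ := Set.mem_iUnion.1 ha
    obtain ⟨n, hn⟩ := Set.mem_iUnion.1 hb
    have hm' := div_idealPow_mono I (le_max_left m n) hm
    have hn' := div_idealPow_mono I (le_max_right m n) hn
    refine Set.mem_iUnion.2 ⟨max m n, ?_⟩
    simp only [SetLike.mem_coe, Submodule.mem_div_iff_forall_mul_mem] at hm' hn' ⊢
    intro y hy
    rw [mul_assoc]
    exact hm' _ (hn' _ hy)
  add_mem' := by
    intro a b ha hb
    obtain ⟨m, hm⟩ := Set.mem_iUnion.1 ha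
    obtain ⟨n, hn⟩ := Set.mem_iUnion.1 hb
    exact Set.mem_iUnion.2 ⟨max m n, add_mem (div_idealPow_mono I (le_max_left m n) hm)
      (div_idealPow_mono I (le_max_right m n) hn)⟩
  algebraMap_mem' := by
    intro r
    refine Set.mem_iUnion.2 ⟨0, ?_⟩
    simp only [SetLike.mem_coe, Submodule.mem_div_iff_forall_mul_mem]
    intro y hy
    rw [← Algebra.smul_def]
    exact Submodule.smul_mem _ r hy

variable (R K) in
/-- The integral closure of `R` in `K`, as an `R`-submodule of `K`. -/
def Rbar : Submodule R K := Subalgebra.toSubmodule (integralClosure R K)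

/-- For a subring `R ⊆ S ⊆ K`, the length over `R` of `R̄ / S` (for `S = R`, the singularity
degree `δ`). -/
def deltaLength (S : Subalgebra R K) : ℕ∞ :=
  quotLength (Rbar R K) (Subalgebra.toSubmodule S)

/-- For a subring `R ⊆ S ⊆ K`, the length over `R` of `R̄ / (S : R̄)` (for `S = R`, the
conductor `c`). -/
def condLength (S : Subalgebra R K) : ℕ∞ :=
  quotLength (Rbar R K) (Subalgebra.toSubmodule S / Rbar R K)

end Fractional

end BlowUp

end

namespace BlowUp

/-! ### Lengths of quotients and finiteness -/

section RelativeLength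

variable {A : Type*} [CommRing A]

/-! Call a nonzero finitely generated submodule of `K` a lattice, and let `deg M` be its length
relative to `R`. Then `ℓ(M/N) = deg M - deg N` for `N ⊆ M`, and multiplication by `y` shifts every
degree by the degree of `yR`. The theorem becomes integer arithmetic with degrees once duality is
available.

Duality: since `Ext¹(k, ω) ≅ k`, the module `(ω : 𝔪)/ω` has length at most one. Hence `deg (ω : M) =
deg ω - deg M` (`deg_div`), so `ω : (ω : M) = M`, `ω : ω = R` and `R : M = ω : ωM`.

Formula: `Λ = x⁻ᵛIᵛ` gives `deg Iᵛ = deg Λ - eν`, and a telescoping sum gives `ρ = deg Λ`. As `ωR̄ =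
R̄`, one has `R : R̄ = ω : R̄`, so `2δ - c = deg ω`. The two correction lengths therefore add up to
`eν + deg ω - 2 deg Λ`. Equality in the bound means that both vanish, which is (c).

Gorenstein property: `Λ` is Gorenstein iff `ω : Λ = yΛ` for some `y ≠ 0`
(`isGorensteinLocalRing_iff_exists_div_eq`), and then `c - c_Λ` is minus the degree of `yR`. Finite
injective dimension of `L` makes the divisible module `K/L` injective, which bounds the type by one;
type one makes the dual of `L` cyclic. Conversely, a cyclic dual makes every `L`-lattice reflexive,
which makes `K/L` injective, and `0 → L → K → K/L → 0` bounds the injective dimension. -/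

theorem length_quotient_map {E F : Type*} [AddCommGroup E] [Module A E] [AddCommGroup F]
    [Module A F] (f : E →ₗ[A] F) (hf : Function.Injective f) (M N : Submodule A E) :
    Module.length A (↥(M.map f) ⧸ (N.map f).submoduleOf (M.map f)) =
      Module.length A (↥M ⧸ N.submoduleOf M) := by
  refine (LinearEquiv.length_eq (Submodule.Quotient.equiv _ _
    (Submodule.equivMapOfInjective f hf M) ?_)).symm
  ext ⟨y, hy⟩
  obtain ⟨m, hm, rfl⟩ := hy
  simp only [Submodule.mem_map, Submodule.submoduleOf, Submodule.mem_comap]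
  constructor
  · rintro ⟨z, hz, h⟩
    exact ⟨z, hz, congrArg Subtype.val h⟩
  · rintro ⟨z, hz, h⟩
    have : z = m := hf h
    subst this
    exact ⟨⟨z, hm⟩, hz, rfl⟩

/-- `X` is a finite module over `A/(a)`, which is Artinian because a nonzerodivisor brings dimension
one down to zero. -/
theorem isFiniteLength_of_smul_eq_zero [IsNoetherianRing A] [Ring.KrullDimLE 1 A] {X : Type*}
    [AddCommGroup X] [Module A X] [Module.Finite A X] {a : A} (ha : a ∈ nonZeroDivisors A)
    (h : ∀ x : X, a • x = 0) : IsFiniteLength A X := by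
  rw [isFiniteLength_iff_isNoetherian_isArtinian]
  refine ⟨inferInstance, ?_⟩
  have ht : Module.IsTorsionBySet A X (Ideal.span {a} : Ideal A) := by
    rw [Module.isTorsionBySet_span_singleton_iff]
    exact fun x => h x
  let _ := ht.module
  have : IsScalarTower A (A ⧸ Ideal.span {a}) X := ht.isScalarTower
  have hfl := (isFiniteLength_iff_isNoetherian_isArtinian.1
    (isFiniteLength_quotient_span_singleton A ha)).2
  have : IsArtinianRing (A ⧸ Ideal.span {a}) := isArtinian_of_tower A hfl
  have : Module.Finite (A ⧸ Ideal.span {a}) X := Module.Finite.of_restrictScalars_finite A _ X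
  exact isArtinian_of_surjective_algebraMap (R := A ⧸ Ideal.span {a}) (S := A)
    Ideal.Quotient.mk_surjective

end RelativeLength

/-! ### Colons, lattices and their degrees -/

section Lattice

variable {A : Type u} [CommRing A] {K : Type u} [Field K] [Algebra A K]

theorem quotLength_eq_zero_iff {M N : Submodule A K} : quotLength M N = 0 ↔ M ≤ N := by
  rw [quotLength, Module.length_eq_zero_iff, Submodule.Quotient.subsingleton_iff,
    Submodule.submoduleOf_eq_top]

theorem quotLength_add {M N P : Submodule A K} (hPN : P ≤ N) (hNM : N ≤ M) :
    quotLength M P = quotLength N P + quotLength M N := by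
  have h1 : P.submoduleOf N ≤ (P.submoduleOf M).comap (Submodule.inclusion hNM) :=
    fun x hx => hx
  have h2 : P.submoduleOf M ≤ (N.submoduleOf M).comap LinearMap.id := fun x hx => hPN hx
  refine Module.length_eq_add_of_exact
    (Submodule.mapQ _ _ (Submodule.inclusion hNM) h1) (Submodule.mapQ _ _ LinearMap.id h2)
    ?_ ?_ ?_
  · rw [← LinearMap.ker_eq_bot, Submodule.ker_mapQ, ← le_bot_iff, Submodule.map_le_iff_le_comap]
    intro x hx
    rw [Submodule.mem_comap, Submodule.mem_bot, Submodule.mkQ_apply, Submodule.Quotient.mk_eq_zero]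
    exact hx
  · intro y
    obtain ⟨y, rfl⟩ := Submodule.Quotient.mk_surjective _ y
    exact ⟨Submodule.Quotient.mk y, rfl⟩
  · intro y
    obtain ⟨y, rfl⟩ := Submodule.Quotient.mk_surjective _ y
    rw [Submodule.mapQ_apply, LinearMap.id_apply, Submodule.Quotient.mk_eq_zero]
    constructor
    · intro hy
      exact ⟨Submodule.Quotient.mk ⟨y.1, hy⟩, rfl⟩
    · rintro ⟨z, hz⟩
      obtain ⟨z, rfl⟩ := Submodule.Quotient.mk_surjective _ z
      rw [Submodule.mapQ_apply, Submodule.Quotient.eq] at hz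
      have h3 : (z : K) - y ∈ N := hPN hz
      have := N.sub_mem z.2 h3
      simpa [Submodule.submoduleOf] using this

theorem span_singleton_mul_eq_map (y : K) (M : Submodule A K) :
    Submodule.span A {y} * M = M.map (LinearMap.mulLeft A y) := by
  ext z
  simp [Submodule.mem_span_singleton_mul]

theorem quotLength_span_singleton_mul {y : K} (hy : y ≠ 0) (M N : Submodule A K) :
    quotLength (Submodule.span A {y} * M) (Submodule.span A {y} * N) = quotLength M N := by
  rw [span_singleton_mul_eq_map, span_singleton_mul_eq_map]
  exact length_quotient_map _ (mul_right_injective₀ hy) M N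

variable (A) in
theorem span_singleton_inv_mul_span_singleton {y : K} (hy : y ≠ 0) :
    Submodule.span A {y⁻¹} * Submodule.span A {y} = 1 := by
  rw [Submodule.span_mul_span, Set.singleton_mul_singleton, inv_mul_cancel₀ hy,
    Submodule.one_eq_span]

theorem span_singleton_mul_le_iff {y : K} (hy : y ≠ 0) {M N : Submodule A K} :
    Submodule.span A {y} * M ≤ N ↔ M ≤ Submodule.span A {y⁻¹} * N := by
  constructor
  · intro h
    have := mul_le_mul_right h (Submodule.span A {y⁻¹})
    rwa [← mul_assoc, span_singleton_inv_mul_span_singleton A hy, one_mul] at this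
  · intro h
    have := mul_le_mul_right h (Submodule.span A {y})
    rwa [← mul_assoc, mul_comm (Submodule.span A {y}) (Submodule.span A {y⁻¹}),
      span_singleton_inv_mul_span_singleton A hy, one_mul] at this

theorem div_mul_eq_div_div (M N P : Submodule A K) : M / (N * P) = (M / N) / P := by
  refine eq_of_forall_le_iff fun Q => ?_
  rw [Submodule.le_div_iff_mul_le, Submodule.le_div_iff_mul_le, Submodule.le_div_iff_mul_le,
    mul_assoc, mul_comm P N]

theorem div_le_div_left {M N : Submodule A K} (h : N ≤ M) (W : Submodule A K) :
    W / M ≤ W / N := by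
  rw [Submodule.le_div_iff_mul_le]
  exact (mul_le_mul_right h _).trans (Submodule.le_div_iff_mul_le.1 le_rfl)

theorem div_le_div_right {M N : Submodule A K} (h : N ≤ M) (W : Submodule A K) :
    N / W ≤ M / W := by
  rw [Submodule.le_div_iff_mul_le]
  exact (Submodule.le_div_iff_mul_le.1 le_rfl).trans h

theorem le_div_div (W M : Submodule A K) : M ≤ W / (W / M) := by
  rw [Submodule.le_div_iff_mul_le, mul_comm]
  exact Submodule.le_div_iff_mul_le.1 le_rfl

theorem div_one' (M : Submodule A K) : M / 1 = M := by
  refine eq_of_forall_le_iff fun Q => ?_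
  rw [Submodule.le_div_iff_mul_le, mul_one]

theorem div_span_singleton_mul {y : K} (hy : y ≠ 0) (M N : Submodule A K) :
    M / (Submodule.span A {y} * N) = Submodule.span A {y⁻¹} * (M / N) := by
  refine eq_of_forall_le_iff fun Q => ?_
  rw [Submodule.le_div_iff_mul_le, ← span_singleton_mul_le_iff hy, Submodule.le_div_iff_mul_le,
    mul_left_comm, mul_assoc]

theorem span_singleton_mul_div {y : K} (hy : y ≠ 0) (M N : Submodule A K) :
    (Submodule.span A {y} * M) / N = Submodule.span A {y} * (M / N) := by
  refine eq_of_forall_le_iff fun Q => ?_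
  have h := fun P Q : Submodule A K =>
    span_singleton_mul_le_iff (A := A) (inv_ne_zero hy) (M := P) (N := Q)
  rw [inv_inv] at h
  rw [Submodule.le_div_iff_mul_le, ← h, ← h, Submodule.le_div_iff_mul_le, mul_assoc]

/-- A nonzero finitely generated submodule of the fraction field. -/
structure IsLattice (M : Submodule A K) : Prop where
  ne_bot : M ≠ ⊥
  fg : M.FG

namespace IsLattice

theorem one : IsLattice (1 : Submodule A K) :=
  ⟨one_ne_zero, by rw [Submodule.one_eq_span]; exact Submodule.fg_span_singleton 1⟩

theorem sup {M N : Submodule A K} (hM : IsLattice M) (hN : IsLattice N) : IsLattice (M ⊔ N) :=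
  ⟨fun h => hM.ne_bot (le_bot_iff.1 (le_sup_left.trans h.le)), hM.fg.sup hN.fg⟩

theorem mul {M N : Submodule A K} (hM : IsLattice M) (hN : IsLattice N) : IsLattice (M * N) :=
  ⟨fun h => (Submodule.mul_eq_bot.1 h).elim hM.ne_bot hN.ne_bot, hM.fg.mul hN.fg⟩

theorem span_singleton {y : K} (hy : y ≠ 0) : IsLattice (Submodule.span A {y}) :=
  ⟨by simpa using hy, Submodule.fg_span_singleton y⟩

theorem exists_mem_ne_zero {M : Submodule A K} (hM : IsLattice M) : ∃ y ∈ M, y ≠ 0 :=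
  M.ne_bot_iff.1 hM.ne_bot

theorem of_le [IsNoetherianRing A] {M N : Submodule A K} (hM : IsLattice M) (hN : N ≠ ⊥)
    (h : N ≤ M) :
    IsLattice N := by
  refine ⟨hN, ?_⟩
  have : IsNoetherian A M := isNoetherian_of_fg_of_noetherian M hM.fg
  exact Submodule.FG.of_le hM.fg h

variable [IsDomain A] [IsFractionRing A K]

theorem exists_span_singleton_mul_le {M N : Submodule A K} (hM : IsLattice M)
    (hN : IsLattice N) :
    ∃ b ∈ nonZeroDivisors A, Submodule.span A {algebraMap A K b} * M ≤ N := by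
  obtain ⟨n, hn, hn0⟩ := hN.exists_mem_ne_zero
  have hF : IsLattice (Submodule.span A {n⁻¹} * M) :=
    (IsLattice.span_singleton (inv_ne_zero hn0)).mul hM
  obtain ⟨S, hS⟩ := hF.fg
  obtain ⟨b, hb⟩ := IsLocalization.exist_integer_multiples_of_finset (nonZeroDivisors A) S
  refine ⟨b, b.2, ?_⟩
  rintro z hz
  obtain ⟨m, hm, rfl⟩ := Submodule.mem_span_singleton_mul.1 hz
  have h1 : n⁻¹ * m ∈ Submodule.span A (S : Set K) := by
    rw [hS]
    exact Submodule.mul_mem_mul (Submodule.mem_span_singleton_self _) hm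
  have h2 : ∀ s ∈ Submodule.span A (S : Set K), algebraMap A K b * s * n ∈ N := by
    intro s hs
    induction hs using Submodule.span_induction with
    | mem s hs =>
      obtain ⟨c, hc⟩ := hb s hs
      rw [Algebra.smul_def] at hc
      rw [← hc, ← Algebra.smul_def]
      exact N.smul_mem c hn
    | zero => simp
    | add s t _ _ hs ht => rw [mul_add, add_mul]; exact N.add_mem hs ht
    | smul c s _ hs =>
      rw [mul_smul_comm, smul_mul_assoc]; exact N.smul_mem c hs
  have := h2 _ h1
  rwa [show algebraMap A K b * (n⁻¹ * m) * n = algebraMap A K b * m by field_simp] at this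

variable [IsNoetherianRing A]

theorem div {M N : Submodule A K} (hM : IsLattice M) (hN : IsLattice N) : IsLattice (M / N) := by
  obtain ⟨n, hn, hn0⟩ := hN.exists_mem_ne_zero
  refine IsLattice.of_le ((IsLattice.span_singleton (A := A) (inv_ne_zero hn0)).mul hM) ?_ ?_
  · obtain ⟨b, hb, h⟩ := hN.exists_span_singleton_mul_le hM
    rw [← Submodule.le_div_iff_mul_le] at h
    intro h0
    rw [h0, le_bot_iff, Submodule.span_singleton_eq_bot] at h
    exact (nonZeroDivisors.ne_zero hb) ((IsFractionRing.injective A K) (by simpa using h))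
  · rw [← span_singleton_mul_le_iff hn0, mul_comm]
    exact (mul_le_mul_right ((Submodule.span_singleton_le_iff_mem _ _).2 hn) _).trans
      (Submodule.le_div_iff_mul_le.1 le_rfl)

variable [Ring.KrullDimLE 1 A]

theorem quotLength_ne_top {M N : Submodule A K} (hM : IsLattice M) (hN : IsLattice N) :
    quotLength M N ≠ ⊤ := by
  obtain ⟨b, hb, h⟩ := hM.exists_span_singleton_mul_le hN
  have : Module.Finite A M := Module.Finite.iff_fg.2 hM.fg
  refine Module.length_ne_top_iff.2 (isFiniteLength_of_smul_eq_zero hb fun x => ?_)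
  obtain ⟨x, rfl⟩ := Submodule.Quotient.mk_surjective _ x
  rw [← Submodule.Quotient.mk_smul, Submodule.Quotient.mk_eq_zero]
  change ((b • x : M) : K) ∈ N
  rw [Submodule.coe_smul, Algebra.smul_def]
  exact h (Submodule.mul_mem_mul (Submodule.mem_span_singleton_self _) x.2)

end IsLattice

/-- The degree of a lattice: its length relative to the lattice `A`. -/
noncomputable def deg (M : Submodule A K) : ℤ :=
  ((quotLength (M ⊔ 1) 1).toNat : ℤ) - ((quotLength (M ⊔ 1) M).toNat : ℤ)

theorem deg_one : deg (1 : Submodule A K) = 0 := by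
  simp [deg]

variable [IsDomain A] [IsNoetherianRing A] [IsFractionRing A K] [Ring.KrullDimLE 1 A]

theorem toNat_quotLength_add {M N P : Submodule A K} (hM : IsLattice M) (hN : IsLattice N)
    (hP : IsLattice P) (hPN : P ≤ N) (hNM : N ≤ M) :
    (quotLength M P).toNat = (quotLength N P).toNat + (quotLength M N).toNat := by
  rw [quotLength_add hPN hNM,
    ENat.toNat_add (hN.quotLength_ne_top hP) (hM.quotLength_ne_top hN)]

/-- Both lengths in `deg` are measured inside `M ⊔ 1`; passing to a larger ambient lattice changes
them equally, so `deg` is additive. All later length comparisons go through this. -/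
theorem toNat_quotLength {M N : Submodule A K} (hM : IsLattice M) (hN : IsLattice N)
    (h : N ≤ M) : ((quotLength M N).toNat : ℤ) = deg M - deg N := by
  have h1 := IsLattice.one (A := A) (K := K)
  have hM1 := hM.sup h1
  have hN1 := hN.sup h1
  have hle : N ⊔ 1 ≤ M ⊔ 1 := sup_le_sup_right h 1
  have e1 := toNat_quotLength_add hM1 hM hN h le_sup_left
  have e2 := toNat_quotLength_add hM1 hN1 hN le_sup_left hle
  have e3 := toNat_quotLength_add hM1 hN1 h1 le_sup_right hle
  unfold deg
  lia

theorem eq_of_le_of_deg_le {M N : Submodule A K} (hM : IsLattice M) (hN : IsLattice N)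
    (h : N ≤ M) (hd : deg M ≤ deg N) : N = M := by
  have := toNat_quotLength hM hN h
  have h0 : (quotLength M N).toNat = 0 := by lia
  rw [ENat.toNat_eq_zero, or_iff_left (hM.quotLength_ne_top hN), quotLength_eq_zero_iff] at h0
  exact le_antisymm h h0

theorem deg_lt {M N : Submodule A K} (hM : IsLattice M) (hN : IsLattice N) (h : N < M) :
    deg N < deg M := by
  by_contra hd
  exact h.ne (eq_of_le_of_deg_le hM hN h.le (not_lt.1 hd))

/-- Multiplication by a nonzero element shifts all degrees by the same amount. -/
theorem deg_span_singleton_mul {y : K} (hy : y ≠ 0) {M : Submodule A K} (hM : IsLattice M) :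
    deg (Submodule.span A {y} * M) = deg M + deg (Submodule.span A {y}) := by
  have hs := IsLattice.span_singleton (A := A) hy
  have key : ∀ N : Submodule A K, IsLattice N → N ≤ M ⊔ 1 →
      deg (Submodule.span A {y} * (M ⊔ 1)) - deg (Submodule.span A {y} * N) =
        deg (M ⊔ 1) - deg N := by
    intro N hN h
    have h1 := hM.sup (IsLattice.one (A := A) (K := K))
    rw [← toNat_quotLength h1 hN h, ← toNat_quotLength (hs.mul h1) (hs.mul hN)
      (mul_le_mul_right h _), quotLength_span_singleton_mul hy]
  have k1 := key M hM le_sup_left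
  have k2 := key 1 IsLattice.one le_sup_right
  rw [mul_one, deg_one] at k2
  lia

theorem deg_span_pow {y : K} (hy : y ≠ 0) (n : ℕ) :
    deg (Submodule.span A {y ^ n}) = n * deg (Submodule.span A {y}) := by
  induction n with
  | zero => simp [← Submodule.one_eq_span, deg_one]
  | succ n ih =>
    rw [pow_succ', ← Set.singleton_mul_singleton, ← Submodule.span_mul_span,
      deg_span_singleton_mul hy (IsLattice.span_singleton (pow_ne_zero n hy)), ih]
    push_cast
    ring

/-- An integer-valued function which grows along minimal inclusions of lattices grows along all
inclusions. -/
theorem le_of_forall_covBy (f : Submodule A K → ℤ)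
    (hf : ∀ M N : Submodule A K, IsLattice M → IsLattice N → N ⋖ M → f N ≤ f M)
    {M N : Submodule A K} (hM : IsLattice M) (hN : IsLattice N) (h : N ≤ M) : f N ≤ f M := by
  obtain ⟨n, hn⟩ : ∃ n : ℕ, (quotLength M N).toNat = n := ⟨_, rfl⟩
  induction n using Nat.strong_induction_on generalizing M N with
  | _ n ih =>
    rcases h.eq_or_lt with rfl | hlt
    · exact le_rfl
    by_cases hc : N ⋖ M
    · exact hf M N hM hN hc
    · obtain ⟨P, hNP, hPM⟩ := (not_covBy_iff hlt).1 hc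
      have hP : IsLattice P :=
        hM.of_le (fun h0 => hN.ne_bot (le_bot_iff.1 (hNP.le.trans h0.le))) hPM.le
      have e := toNat_quotLength hM hN h
      have e1 := toNat_quotLength hM hP hPM.le
      have e2 := toNat_quotLength hP hN hNP.le
      have l1 := deg_lt hM hP hPM
      have l2 := deg_lt hP hN hNP
      exact (ih _ (by lia) hP hN hNP.le rfl).trans (ih _ (by lia) hM hP hPM.le rfl)

end Lattice

/-! ### Colons along minimal inclusions -/

section Comparison

variable {A : Type u} [CommRing A] {K : Type u} [Field K] [Algebra A K]

theorem quotLength_le_of_mul {P P' Q Q' : Submodule A K} (y : K) (h : ∀ p ∈ P, y * p ∈ Q)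
    (h' : ∀ p ∈ P, y * p ∈ Q' ↔ p ∈ P') : quotLength P P' ≤ quotLength Q Q' := by
  have hle : P'.submoduleOf P ≤
      (Q'.submoduleOf Q).comap ((LinearMap.mulLeft A y).restrict h) :=
    fun p hp => (h' p p.2).2 hp
  refine Module.length_le_of_injective (Submodule.mapQ _ _ _ hle) ?_
  rw [← LinearMap.ker_eq_bot, Submodule.ker_mapQ, ← le_bot_iff, Submodule.map_le_iff_le_comap]
  intro x hx
  rw [Submodule.mem_comap, Submodule.mem_bot, Submodule.mkQ_apply, Submodule.Quotient.mk_eq_zero]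
  exact (h' x x.2).1 hx

theorem quotLength_ge_of_mul {P P' Q Q' : Submodule A K} (y : K) (h : ∀ p ∈ P, y * p ∈ Q)
    (h' : ∀ p ∈ P, p ∈ P' → y * p ∈ Q') (hs : ∀ q ∈ Q, ∃ p ∈ P, y * p - q ∈ Q') :
    quotLength Q Q' ≤ quotLength P P' := by
  have hle : P'.submoduleOf P ≤
      (Q'.submoduleOf Q).comap ((LinearMap.mulLeft A y).restrict h) :=
    fun p hp => h' p p.2 hp
  refine Module.length_le_of_surjective (Submodule.mapQ _ _ _ hle) fun q => ?_
  obtain ⟨⟨q, hq⟩, rfl⟩ := Submodule.Quotient.mk_surjective _ q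
  obtain ⟨p, hp, hpq⟩ := hs q hq
  refine ⟨Submodule.Quotient.mk ⟨p, hp⟩, ?_⟩
  rw [Submodule.mapQ_apply, Submodule.Quotient.eq]
  exact hpq

theorem quotLength_eq_one_of_covBy {M N : Submodule A K} (h : N ⋖ M) : quotLength M N = 1 := by
  have : IsSimpleModule A (↥M ⧸ N.submoduleOf M) := (covBy_iff_quot_is_simple h.le).1 h
  exact Module.length_eq_one _ _

theorem eq_or_eq_of_quotLength_le_one {P Q X : Submodule A K} (h : quotLength P Q ≤ 1)
    (hQX : Q ≤ X) (hXP : X ≤ P) : X = Q ∨ X = P := by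
  by_contra! hne
  have h1 : quotLength X Q ≠ 0 := fun h0 => hne.1 (le_antisymm (quotLength_eq_zero_iff.1 h0) hQX)
  have h2 : quotLength P X ≠ 0 := fun h0 => hne.2 (le_antisymm hXP (quotLength_eq_zero_iff.1 h0))
  rw [quotLength_add hQX hXP] at h
  have h3 : (1 : ℕ∞) + 1 ≤ 1 :=
    (add_le_add (Order.one_le_iff_ne_zero.2 h1) (Order.one_le_iff_ne_zero.2 h2)).trans h
  exact absurd h3 (by decide)

theorem sup_span_singleton_eq_of_covBy {M N : Submodule A K} (h : N ⋖ M) {y : K} (hy : y ∈ M)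
    (hyN : y ∉ N) : N ⊔ Submodule.span A {y} = M := by
  have hle : N ⊔ Submodule.span A {y} ≤ M :=
    sup_le h.le ((Submodule.span_singleton_le_iff_mem _ _).2 hy)
  refine (h.eq_or_eq le_sup_left hle).resolve_left fun h0 => hyN ?_
  rw [← h0]
  exact Submodule.mem_sup_right (Submodule.mem_span_singleton_self y)

theorem mem_div_sup_span_singleton {W N : Submodule A K} {y z : K} :
    z ∈ W / (N ⊔ Submodule.span A {y}) ↔ z ∈ W / N ∧ y * z ∈ W := by
  simp only [Submodule.mem_div_iff_forall_mul_mem]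
  constructor
  · intro h
    refine ⟨fun n hn => h n (Submodule.mem_sup_left hn), ?_⟩
    rw [mul_comm]
    exact h y (Submodule.mem_sup_right (Submodule.mem_span_singleton_self y))
  · rintro ⟨h1, h2⟩ w hw
    obtain ⟨n, hn, v, hv, rfl⟩ := Submodule.mem_sup.1 hw
    obtain ⟨a, rfl⟩ := Submodule.mem_span_singleton.1 hv
    rw [mul_add, mul_smul_comm, mul_comm z y]
    exact W.add_mem (h1 n hn) (W.smul_mem a h2)

variable (A K) in
/-- The maximal ideal of `A`, as a submodule of `K`. -/
noncomputable abbrev maxSubmodule [IsLocalRing A] : Submodule A K :=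
  IsLocalization.coeSubmodule K (IsLocalRing.maximalIdeal A)

variable [IsLocalRing A]

theorem mem_div_maxSubmodule {W : Submodule A K} {z : K} :
    z ∈ W / maxSubmodule A K ↔ ∀ a ∈ IsLocalRing.maximalIdeal A, a • z ∈ W := by
  simp only [Submodule.mem_div_iff_forall_mul_mem, IsLocalization.mem_coeSubmodule]
  constructor
  · intro h a ha
    rw [Algebra.smul_def, mul_comm]
    exact h _ ⟨a, ha, rfl⟩
  · rintro h _ ⟨a, ha, rfl⟩
    rw [mul_comm, ← Algebra.smul_def]
    exact h a ha

theorem smul_mem_of_covBy {M N : Submodule A K} (hM : M.FG) (h : N ⋖ M) {a : A}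
    (ha : a ∈ IsLocalRing.maximalIdeal A) {y : K} (hy : y ∈ M) : a • y ∈ N := by
  have hle : N ⊔ IsLocalRing.maximalIdeal A • M ≤ M := sup_le h.le Submodule.smul_le_right
  rcases h.eq_or_eq le_sup_left hle with h0 | h0
  · rw [← h0]
    exact Submodule.mem_sup_right (Submodule.smul_mem_smul ha hy)
  · exact absurd (Submodule.le_of_le_smul_of_le_jacobson_bot hM
      (IsLocalRing.jacobson_eq_maximalIdeal ⊥ bot_ne_top).ge h0.ge) h.lt.not_ge

theorem mul_mem_div_maxSubmodule_of_covBy {W M N : Submodule A K} (hM : M.FG) (h : N ⋖ M)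
    {y z : K} (hy : y ∈ M) (hz : z ∈ W / N) : y * z ∈ W / maxSubmodule A K := by
  rw [mem_div_maxSubmodule]
  intro a ha
  rw [mul_comm, ← mul_smul_comm]
  exact Submodule.mem_div_iff_forall_mul_mem.1 hz _ (smul_mem_of_covBy hM h ha hy)

/-- For `y ∈ M \ N` one has `M = N + Ay` and `𝔪M ⊆ N`, so multiplication by `y` embeds `(W : N)/(W :
M)` into `(W : 𝔪)/W`. -/
theorem quotLength_div_le_of_covBy {W M N : Submodule A K} (hM : M.FG) (h : N ⋖ M) :
    quotLength (W / N) (W / M) ≤ quotLength (W / maxSubmodule A K) W := by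
  obtain ⟨y, hy, hyN⟩ := SetLike.exists_of_lt h.lt
  refine quotLength_le_of_mul y
    (fun p hp => mul_mem_div_maxSubmodule_of_covBy hM h hy hp) fun p hp => ?_
  rw [← sup_span_singleton_eq_of_covBy h hy hyN, mem_div_sup_span_singleton]
  exact ⟨fun h => ⟨hp, h⟩, fun h => h.2⟩

end Comparison

/-! ### Duality with respect to a lattice of type one -/

section Duality

variable {A : Type u} [CommRing A] [IsDomain A] [IsNoetherianRing A] [Ring.KrullDimLE 1 A]
  [IsLocalRing A] {K : Type u} [Field K] [Algebra A K] [IsFractionRing A K]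

theorem deg_div_add_deg_mono {W : Submodule A K} (hW : IsLattice W)
    (ht : quotLength (W / maxSubmodule A K) W ≤ 1) {M N : Submodule A K} (hM : IsLattice M)
    (hN : IsLattice N) (h : N ≤ M) : deg (W / N) + deg N ≤ deg (W / M) + deg M := by
  refine le_of_forall_covBy (fun M => deg (W / M) + deg M) (fun M N hM hN hc => ?_) hM hN h
  have h1 := (quotLength_div_le_of_covBy (W := W) hM.fg hc).trans ht
  have h2 : (quotLength (W / N) (W / M)).toNat ≤ 1 := ENat.toNat_le_of_le_natCast h1
  have e1 := toNat_quotLength (hW.div hN) (hW.div hM) (div_le_div_left hc.le W)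
  have e2 := toNat_quotLength hM hN hc.le
  rw [quotLength_eq_one_of_covBy hc] at e2
  simp only [ENat.toNat_one, Nat.cast_one] at e2
  lia

/-- Duality with respect to a lattice of type one reverses degrees. -/
theorem deg_div {W : Submodule A K} (hW : IsLattice W)
    (ht : quotLength (W / maxSubmodule A K) W ≤ 1) {M : Submodule A K} (hM : IsLattice M) :
    deg (W / M) = deg W - deg M := by
  -- `deg (W : M) + deg M` is monotone in `M` and unchanged by scaling `M`. Any lattice can be
  -- scaled into any other, so this quantity is constant; its value at `M = A` is `deg W`.
  have key : ∀ {M N : Submodule A K}, IsLattice M → IsLattice N →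
      deg (W / M) + deg M ≤ deg (W / N) + deg N := by
    intro M N hM hN
    obtain ⟨b, hb, h⟩ := hM.exists_span_singleton_mul_le hN
    have hb0 : algebraMap A K b ≠ 0 := by simpa using nonZeroDivisors.ne_zero hb
    have h1 := deg_div_add_deg_mono hW ht hN ((IsLattice.span_singleton hb0).mul hM) h
    rw [div_span_singleton_mul hb0, deg_span_singleton_mul hb0 hM,
      deg_span_singleton_mul (inv_ne_zero hb0) (hW.div hM)] at h1
    have h2 := deg_span_singleton_mul (inv_ne_zero hb0) (IsLattice.span_singleton (A := A) hb0)
    rw [span_singleton_inv_mul_span_singleton A hb0, deg_one] at h2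
    lia
  have h1 := key hM IsLattice.one
  have h2 := key IsLattice.one hM
  rw [div_one', deg_one] at h1 h2
  lia

theorem div_div_cancel_of_type_one {W : Submodule A K} (hW : IsLattice W)
    (ht : quotLength (W / maxSubmodule A K) W ≤ 1) {M : Submodule A K} (hM : IsLattice M) :
    W / (W / M) = M := by
  refine (eq_of_le_of_deg_le (hW.div (hW.div hM)) hM (le_div_div W M) ?_).symm
  rw [deg_div hW ht (hW.div hM), deg_div hW ht hM]
  lia

end Duality

/-! ### Injective and divisible modules -/

section Injective

variable {A : Type u} [CommRing A]

theorem exists_linearMap_apply_eq_of_injective {E X : Type u} [AddCommGroup E] [Module A E]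
    [AddCommGroup X] [Module A X] [Module.Injective A E] (x : X) (e : E)
    (h : Ideal.torsionOf A X x ≤ Ideal.torsionOf A E e) : ∃ g : X →ₗ[A] E, g x = e := by
  let φ : ↥(Submodule.span A {x}) →ₗ[A] E :=
    (Submodule.liftQ (Ideal.torsionOf A X x) (LinearMap.toSpanSingleton A E e) h).comp
      (Ideal.quotTorsionOfEquivSpanSingleton A X x).symm.toLinearMap
  obtain ⟨g, hg⟩ := Module.Injective.out (Submodule.span A {x}).subtype
    (Submodule.subtype_injective _) φ
  refine ⟨g, ?_⟩
  have h1 := hg ⟨x, Submodule.mem_span_singleton_self x⟩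
  have h2 : (Ideal.quotTorsionOfEquivSpanSingleton A X x).symm
      ⟨x, Submodule.mem_span_singleton_self x⟩ = Submodule.Quotient.mk 1 := by
    rw [LinearEquiv.symm_apply_eq, Ideal.quotTorsionOfEquivSpanSingleton_apply_mk, one_smul]
  simp only [Submodule.subtype_apply] at h1
  rw [h1]
  simp only [φ, LinearMap.comp_apply, LinearEquiv.coe_coe, h2]
  exact one_smul A e

/-- The short exact sequence `0 → D → E → E / D → 0` of a submodule. -/
theorem shortExact_subtype_mkQ {E : Type u} [AddCommGroup E] [Module A E] (D : Submodule A E) :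
    (ShortComplex.mk (ModuleCat.ofHom D.subtype) (ModuleCat.ofHom D.mkQ)
      (by ext x; simp)).ShortExact := by
  have h1 : Mono (ModuleCat.ofHom D.subtype) :=
    (ModuleCat.mono_iff_injective _).2 (Submodule.subtype_injective _)
  have h2 : Epi (ModuleCat.ofHom D.mkQ) :=
    (ModuleCat.epi_iff_surjective _).2 (Submodule.mkQ_surjective _)
  refine { exact := ?_, mono_f := h1, epi_g := h2 }
  rw [ShortComplex.moduleCat_exact_iff]
  intro x hx
  exact ⟨⟨x, (Submodule.Quotient.mk_eq_zero _).1 hx⟩, rfl⟩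

theorem hasInjectiveDimensionLT_quotient {E : Type u} [AddCommGroup E] [Module A E]
    [hE : Module.Injective A E] (D : Submodule A E) (n : ℕ)
    (h : HasInjectiveDimensionLT (ModuleCat.of A D) (n + 2)) :
    HasInjectiveDimensionLT (ModuleCat.of A (E ⧸ D)) (n + 1) :=
  ((shortExact_subtype_mkQ D).hasInjectiveDimensionLT_X₃_iff n
    (Module.injective_object_of_injective_module A E)).2 h

theorem hasInjectiveDimensionLT_two_of_quotient {E : Type u} [AddCommGroup E] [Module A E]
    [hE : Module.Injective A E] (D : Submodule A E) [hD : Module.Injective A (E ⧸ D)] :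
    HasInjectiveDimensionLT (ModuleCat.of A D) 2 := by
  have := Module.injective_object_of_injective_module A (E ⧸ D)
  exact ((shortExact_subtype_mkQ D).hasInjectiveDimensionLT_X₃_iff 0
    (Module.injective_object_of_injective_module A E)).1
      (inferInstanceAs (HasInjectiveDimensionLT (ModuleCat.of A (E ⧸ D)) 1))

theorem exists_injective_submodule_equiv (D : Type u) [AddCommGroup D] [Module A D] :
    ∃ (E : Type u) (_ : AddCommGroup E) (_ : Module A E) (_ : Module.Injective A E)
      (D' : Submodule A E), Nonempty (D ≃ₗ[A] D') := by
  let ι := Injective.ι (ModuleCat.of A D)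
  have hι : Function.Injective ι.hom := (ModuleCat.mono_iff_injective ι).1 inferInstance
  have hE : Module.Injective A (Injective.under (ModuleCat.of A D) : ModuleCat A) :=
    (Module.injective_iff_injective_object A (Injective.under (ModuleCat.of A D) : ModuleCat A)).2
      (inferInstanceAs (Injective (Injective.under (ModuleCat.of A D))))
  exact ⟨_, _, _, hE, LinearMap.range ι.hom, ⟨LinearEquiv.ofInjective ι.hom hι⟩⟩

/-- A module is divisible if multiplication by every nonzero scalar is surjective on it. -/
def IsDivisible (A : Type u) [CommRing A] (D : Type u) [AddCommGroup D] [Module A D] : Prop :=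
  ∀ a : A, a ≠ 0 → ∀ d : D, ∃ d' : D, a • d' = d

theorem IsDivisible.quotient {E : Type u} [AddCommGroup E] [Module A E] (h : IsDivisible A E)
    (D : Submodule A E) : IsDivisible A (E ⧸ D) := by
  intro a ha d
  obtain ⟨d, rfl⟩ := Submodule.Quotient.mk_surjective _ d
  obtain ⟨d', rfl⟩ := h a ha d
  exact ⟨Submodule.Quotient.mk d', rfl⟩

theorem isDivisible_of_injective [IsDomain A] (E : Type u) [AddCommGroup E] [Module A E]
    [Module.Injective A E] : IsDivisible A E := by
  intro a ha e
  obtain ⟨g, hg⟩ := exists_linearMap_apply_eq_of_injective (A := A) (X := A) a e (by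
    intro b hb
    rw [Ideal.mem_torsionOf_iff, smul_eq_mul] at hb
    rw [(mul_eq_zero.1 hb).resolve_right ha]
    exact zero_mem _)
  refine ⟨g 1, ?_⟩
  rw [← map_smul, smul_eq_mul, mul_one, hg]

/-- The fraction field of a domain is an injective module. -/
theorem injective_fractionField [IsDomain A] (K : Type u) [Field K] [Algebra A K]
    [IsFractionRing A K] : Module.Injective A K := by
  refine Module.Baer.injective fun J f => ?_
  by_cases hJ : J = ⊥
  · subst hJ
    refine ⟨0, fun a ha => ?_⟩
    have : (⟨a, ha⟩ : (⊥ : Ideal A)) = 0 := Subtype.ext ((Submodule.mem_bot A).1 ha)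
    rw [this, map_zero, LinearMap.zero_apply]
  · obtain ⟨b, hb, hb0⟩ := J.ne_bot_iff.1 hJ
    have hbK : algebraMap A K b ≠ 0 := by simpa using hb0
    refine ⟨LinearMap.toSpanSingleton A K (f ⟨b, hb⟩ / algebraMap A K b), fun a ha => ?_⟩
    have h : b • f ⟨a, ha⟩ = a • f ⟨b, hb⟩ := by
      rw [← map_smul, ← map_smul]
      congr 1
      exact Subtype.ext (mul_comm b a)
    rw [Algebra.smul_def, Algebra.smul_def] at h
    rw [LinearMap.toSpanSingleton_apply, Algebra.smul_def, ← mul_div_assoc, ← h]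
    field_simp

/-- The class of `s` generates a copy of `k` in `A/J`. The map sending it to `e` extends to `A/J`,
and `e'` is the image of `1`. -/
theorem exists_smul_eq_of_injective [IsLocalRing A] {E : Type u} [AddCommGroup E] [Module A E]
    [Module.Injective A E] {J : Ideal A} {s : A}
    (hs : Ideal.torsionOf A (A ⧸ J) (Submodule.Quotient.mk s) = IsLocalRing.maximalIdeal A)
    {e : E} (he : ∀ a ∈ IsLocalRing.maximalIdeal A, a • e = 0) :
    ∃ e' : E, (∀ j ∈ J, j • e' = 0) ∧ s • e' = e := by
  obtain ⟨g, hg⟩ := exists_linearMap_apply_eq_of_injective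
    (Submodule.Quotient.mk s : A ⧸ J) e (by rw [hs]; exact he)
  refine ⟨g (Submodule.Quotient.mk 1), fun j hj => ?_, ?_⟩
  · rw [← map_smul, ← Submodule.Quotient.mk_smul, smul_eq_mul, mul_one,
      (Submodule.Quotient.mk_eq_zero _).2 hj, map_zero]
  · rw [← map_smul, ← Submodule.Quotient.mk_smul, smul_eq_mul, mul_one, hg]

theorem IsDivisible.of_equiv {D D' : Type u} [AddCommGroup D] [Module A D] [AddCommGroup D']
    [Module A D'] (e : D ≃ₗ[A] D') (h : IsDivisible A D) : IsDivisible A D' := by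
  intro a ha d
  obtain ⟨d', hd'⟩ := h a ha (e.symm d)
  exact ⟨e d', by rw [← map_smul, hd', e.apply_symm_apply]⟩

variable [IsLocalRing A] [IsDomain A] [IsNoetherianRing A] [Ring.KrullDimLE 1 A]

/-- A nonzero torsion module over a one-dimensional local domain has a nonzero socle. -/
theorem exists_torsionOf_eq_maximalIdeal {X : Type u} [AddCommGroup X] [Module A X]
    [Nontrivial X] {b : A} (hb : b ≠ 0) (h : ∀ x : X, b • x = 0) :
    ∃ x : X, x ≠ 0 ∧ Ideal.torsionOf A X x = IsLocalRing.maximalIdeal A := by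
  -- An associated prime contains `b`, so it is nonzero and hence maximal.
  obtain ⟨p, hp⟩ := associatedPrimes.nonempty A X
  obtain ⟨hp1, x, hx⟩ := isAssociatedPrime_iff.1 hp
  have hx' : p = Ideal.torsionOf A X x := by
    rw [hx]
    ext a
    simp [Submodule.mem_colon_singleton]
  have hbp : b ∈ p := by rw [hx', Ideal.mem_torsionOf_iff]; exact h x
  have hpm : p.IsMaximal :=
    hp1.isMaximal_of_ne_bot (fun h0 => hb (by simpa [h0] using hbp))
  refine ⟨x, ?_, ?_⟩
  · rintro rfl
    rw [Ideal.torsionOf_zero] at hx'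
    exact hp1.ne_top hx'
  · rw [← hx']
    exact IsLocalRing.eq_maximalIdeal hpm

theorem exists_notMem_torsionOf_quotient {J : Ideal A} (hJ : J ≠ ⊥) (hJ' : J ≠ ⊤) :
    ∃ s : A, s ∉ J ∧
      Ideal.torsionOf A (A ⧸ J) (Submodule.Quotient.mk s) = IsLocalRing.maximalIdeal A := by
  obtain ⟨b, hb, hb0⟩ := J.ne_bot_iff.1 hJ
  have := Submodule.Quotient.nontrivial_iff.2 hJ'
  obtain ⟨s, hs, h⟩ := exists_torsionOf_eq_maximalIdeal (X := A ⧸ J) hb0 fun x => by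
    obtain ⟨x, rfl⟩ := Submodule.Quotient.mk_surjective _ x
    rw [← Submodule.Quotient.mk_smul, Submodule.Quotient.mk_eq_zero, smul_eq_mul]
    exact J.mul_mem_right x hb
  obtain ⟨s, rfl⟩ := Submodule.Quotient.mk_surjective _ s
  exact ⟨s, fun h0 => hs ((Submodule.Quotient.mk_eq_zero _).2 h0), h⟩

/-! ### Descent of injectivity from `E/D` to `D` -/

section Descent

variable {E : Type u} [AddCommGroup E] [Module A E] {D : Submodule A E}
  [Module.Injective A (E ⧸ D)]

/-- Write `c = s c'` with `b c' = 0` and `𝔪s ⊆ (b)`. For a lift `e` of `c'`, divisibility gives `d ∈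
D` with `bd = be`; then `s(e - d)` lifts `c` and is killed by `𝔪`. -/
theorem exists_lift_of_maximalIdeal_smul_eq_zero (hD : IsDivisible A D)
    (hA : IsLocalRing.maximalIdeal A ≠ ⊥) {c : E ⧸ D}
    (hc : ∀ a ∈ IsLocalRing.maximalIdeal A, a • c = 0) :
    ∃ e : E, D.mkQ e = c ∧ ∀ a ∈ IsLocalRing.maximalIdeal A, a • e = 0 := by
  obtain ⟨b, hb, hb0⟩ := (IsLocalRing.maximalIdeal A).ne_bot_iff.1 hA
  obtain ⟨s, -, hs⟩ := exists_notMem_torsionOf_quotient (J := Ideal.span {b}) (by simpa using hb0)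
    (fun h => (IsLocalRing.mem_maximalIdeal b).1 hb (Ideal.span_singleton_eq_top.1 h))
  obtain ⟨c', hc', rfl⟩ := exists_smul_eq_of_injective hs hc
  obtain ⟨e, rfl⟩ := Submodule.Quotient.mk_surjective _ c'
  have h1 := hc' b (Ideal.mem_span_singleton_self b)
  rw [← Submodule.Quotient.mk_smul, Submodule.Quotient.mk_eq_zero] at h1
  obtain ⟨d, hd⟩ := hD b hb0 ⟨_, h1⟩
  have hd' : b • (d : E) = b • e := congrArg Subtype.val hd
  refine ⟨s • (e - d), ?_, fun a ha => ?_⟩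
  · rw [map_smul, map_sub, Submodule.mkQ_apply, Submodule.mkQ_apply,
      (Submodule.Quotient.mk_eq_zero D).2 d.2, sub_zero]
  · rw [← hs, Ideal.mem_torsionOf_iff, ← Submodule.Quotient.mk_smul,
      Submodule.Quotient.mk_eq_zero, smul_eq_mul, Ideal.mem_span_singleton'] at ha
    obtain ⟨r, hr⟩ := ha
    rw [smul_smul, ← hr, mul_smul, smul_sub, hd', sub_self, smul_zero]

variable [Module.Injective A E]

/-- Noetherian induction from larger ideals to `J`. With `𝔪s ⊆ J`, the socle element `sc` lifts to
some `s e₂` with `J e₂ = 0`; subtracting the class of `e₂` from `c` leaves an element killed by the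
larger ideal `J + (s)`. -/
theorem exists_lift_of_ideal_smul_eq_zero (hD : IsDivisible A D)
    (hA : IsLocalRing.maximalIdeal A ≠ ⊥) (J : Ideal A) (hJ : J ≠ ⊥) {c : E ⧸ D}
    (hc : ∀ a ∈ J, a • c = 0) : ∃ e : E, D.mkQ e = c ∧ ∀ a ∈ J, a • e = 0 := by
  induction J using IsNoetherian.induction generalizing c with
  | hgt J ih =>
    by_cases hJ' : J = ⊤
    · subst hJ'
      have := hc 1 trivial
      rw [one_smul] at this
      exact ⟨0, by rw [this, map_zero], fun a _ => smul_zero a⟩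
    obtain ⟨s, hsJ, hs⟩ := exists_notMem_torsionOf_quotient hJ hJ'
    have hms : ∀ a ∈ IsLocalRing.maximalIdeal A, a * s ∈ J := fun a ha => by
      rw [← hs, Ideal.mem_torsionOf_iff, ← Submodule.Quotient.mk_smul,
        Submodule.Quotient.mk_eq_zero] at ha
      exact ha
    obtain ⟨e₁, he₁, hm⟩ := exists_lift_of_maximalIdeal_smul_eq_zero hD hA (c := s • c)
      fun a ha => by rw [smul_smul]; exact hc _ (hms a ha)
    obtain ⟨e₂, hJe₂, hse₂⟩ := exists_smul_eq_of_injective hs hm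
    have hlt : J < J ⊔ Ideal.span {s} := by
      refine lt_of_le_of_ne le_sup_left fun h => hsJ ?_
      rw [h]
      exact Submodule.mem_sup_right (Ideal.mem_span_singleton_self s)
    obtain ⟨e₃, he₃, hJe₃⟩ := ih (J ⊔ Ideal.span {s}) hlt
      (fun h => hJ (le_bot_iff.1 (hlt.le.trans h.le))) (c := c - D.mkQ e₂) (by
        intro a ha
        obtain ⟨j, hj, t, ht, rfl⟩ := Submodule.mem_sup.1 ha
        obtain ⟨r, rfl⟩ := Ideal.mem_span_singleton'.1 ht
        rw [add_smul, smul_sub, hc j hj, ← map_smul, hJe₂ j hj, map_zero, mul_smul, smul_sub,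
          ← map_smul, hse₂, he₁]
        simp)
    refine ⟨e₂ + e₃, by rw [map_add, he₃]; abel, fun a ha => ?_⟩
    rw [smul_add, hJe₂ a ha, hJe₃ a (hlt.le ha), add_zero]

/-- Baer's criterion: a map `J → D` is multiplication by some `g 1 ∈ E`, whose class in `E/D` is
killed by `J`. Subtracting a lift of that class killed by `J` moves the multiplier into `D`. -/
theorem injective_of_injective_quotient (hD : IsDivisible A D)
    (hA : IsLocalRing.maximalIdeal A ≠ ⊥) : Module.Injective A D := by
  refine Module.Baer.injective fun J f => ?_
  by_cases hJ : J = ⊥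
  · subst hJ
    refine ⟨0, fun a ha => ?_⟩
    have : (⟨a, ha⟩ : (⊥ : Ideal A)) = 0 := Subtype.ext ((Submodule.mem_bot A).1 ha)
    rw [this, map_zero, LinearMap.zero_apply]
  obtain ⟨g, hg⟩ := Module.Injective.out J.subtype (Submodule.subtype_injective _)
    (D.subtype.comp f)
  have hg' : ∀ (a : A) (ha : a ∈ J), a • g 1 = f ⟨a, ha⟩ := fun a ha => by
    have := hg ⟨a, ha⟩
    rw [← map_smul, smul_eq_mul, mul_one]
    exact this
  obtain ⟨e, he, hJe⟩ := exists_lift_of_ideal_smul_eq_zero hD hA J hJ (c := D.mkQ (g 1))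
    fun a ha => by
      rw [← map_smul, hg' a ha]
      exact (Submodule.Quotient.mk_eq_zero D).2 (f ⟨a, ha⟩).2
  have hmem : g 1 - e ∈ D := by
    rw [← Submodule.Quotient.mk_eq_zero D, ← Submodule.mkQ_apply, map_sub, he, sub_self]
  refine ⟨LinearMap.toSpanSingleton A D ⟨g 1 - e, hmem⟩, fun a ha => Subtype.ext ?_⟩
  rw [LinearMap.toSpanSingleton_apply, Submodule.coe_smul, smul_sub, hJe a ha, sub_zero,
    hg' a ha]

end Descent

/-- A divisible module of finite injective dimension over a one-dimensional Noetherian local domain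
is injective. -/
theorem IsDivisible.injective_of_hasInjectiveDimensionLT
    (hA : IsLocalRing.maximalIdeal A ≠ ⊥) (n : ℕ) (D : Type u) [AddCommGroup D] [Module A D]
    (hD : IsDivisible A D) (h : HasInjectiveDimensionLT (ModuleCat.of A D) (n + 1)) :
    Module.Injective A D := by
  induction n generalizing D with
  | zero =>
    exact (Module.injective_iff_injective_object A D).2
      (injective_iff_hasInjectiveDimensionLT_one.2 h)
  | succ n ih =>
    obtain ⟨E, _, _, hE, D', ⟨e⟩⟩ := exists_injective_submodule_equiv (A := A) D
    have hD' : HasInjectiveDimensionLT (ModuleCat.of A D') (n + 2) :=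
      hasInjectiveDimensionLT_of_iso e.toModuleIso (n + 2)
    -- The cokernel `E/D'` is again divisible and its injective dimension bound drops by one, so
    -- induction applies and injectivity descends to `D'`.
    have hQ : Module.Injective A (E ⧸ D') :=
      ih (E ⧸ D') ((isDivisible_of_injective E).quotient D')
        (hasInjectiveDimensionLT_quotient D' n hD')
    have := injective_of_injective_quotient (hD.of_equiv e) hA
    exact Module.Baer.injective
      (Module.Baer.of_equiv e.symm (Module.Baer.of_injective this))

end Injective

/-! ### Injective dimension, type and reflexivity -/

section Gorenstein

variable {A : Type u} [CommRing A] [IsLocalRing A] {K : Type u} [Field K] [Algebra A K]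
  [IsFractionRing A K]

theorem isLattice_maxSubmodule [IsNoetherianRing A] (hA : IsLocalRing.maximalIdeal A ≠ ⊥) :
    IsLattice (maxSubmodule A K) := by
  refine ⟨fun h => hA ?_, ?_⟩
  · exact IsFractionRing.coeSubmodule_injective A K
      (h.trans (IsLocalization.coeSubmodule_bot K).symm)
  · exact (IsLocalization.coeSubmodule_fg K (IsFractionRing.injective A K) _).2
      (IsNoetherian.noetherian _)

variable [IsDomain A]

/-- A domain is isomorphic to its image in the fraction field. -/
noncomputable def equivOne (A : Type u) [CommRing A] [IsDomain A] (K : Type u) [Field K]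
    [Algebra A K] [IsFractionRing A K] : A ≃ₗ[A] (1 : Submodule A K) :=
  (LinearEquiv.ofInjective (Algebra.linearMap A K) (IsFractionRing.injective A K)).trans
    (LinearEquiv.ofEq _ _ Submodule.one_eq_range.symm)

/-- Here multiplication by `y` maps `(1 : N)/(1 : M)` onto `(1 : 𝔪)/1`. Given `q ∈ 1 : 𝔪`, the
annihilator of `y` modulo `N` lies in `𝔪`, so injectivity gives a map `K/N → K/A` sending `y` to
`q`. Since `M ⊆ b⁻¹A`, on `M/N` this map is multiplication by an element of `K`. -/
theorem quotLength_one_div_ge_of_covBy [Module.Injective A (K ⧸ (1 : Submodule A K))]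
    {M N : Submodule A K} (hM : IsLattice M) (h : N ⋖ M) :
    quotLength (1 / maxSubmodule A K) 1 ≤ quotLength (1 / N) (1 / M) := by
  obtain ⟨y, hy, hyN⟩ := SetLike.exists_of_lt h.lt
  refine quotLength_ge_of_mul y
    (fun p hp => mul_mem_div_maxSubmodule_of_covBy hM.fg h hy hp)
    (fun p _ hp' => by rw [mul_comm]; exact Submodule.mem_div_iff_forall_mul_mem.1 hp' y hy)
    fun q hq => ?_
  obtain ⟨g, hg⟩ := exists_linearMap_apply_eq_of_injective (A := A)
    (Submodule.Quotient.mk y : K ⧸ N) (Submodule.Quotient.mk q : K ⧸ (1 : Submodule A K)) (by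
      intro a ha
      rw [Ideal.mem_torsionOf_iff, ← Submodule.Quotient.mk_smul,
        Submodule.Quotient.mk_eq_zero] at ha ⊢
      refine mem_div_maxSubmodule.1 hq a ((IsLocalRing.mem_maximalIdeal a).2 fun hu => hyN ?_)
      exact (Submodule.smul_mem_iff_of_isUnit N hu).1 ha)
  obtain ⟨b, hb, hbM⟩ := hM.exists_span_singleton_mul_le IsLattice.one
  have hb0 : algebraMap A K b ≠ 0 := by simpa using nonZeroDivisors.ne_zero hb
  obtain ⟨z, hz⟩ := Submodule.Quotient.mk_surjective _
    (g (Submodule.Quotient.mk (algebraMap A K b)⁻¹))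
  have key : ∀ w ∈ M, g (Submodule.Quotient.mk w) =
      Submodule.Quotient.mk (w * (algebraMap A K b * z)) := by
    intro w hw
    obtain ⟨c, hc⟩ := Submodule.mem_one.1
      (hbM (Submodule.mul_mem_mul (Submodule.mem_span_singleton_self _) hw))
    have hw' : w = c • (algebraMap A K b)⁻¹ := by
      rw [Algebra.smul_def, hc]
      field_simp
    have e1 : g (Submodule.Quotient.mk w) = c • Submodule.Quotient.mk z := by
      rw [hz, ← map_smul, ← Submodule.Quotient.mk_smul, ← hw']
    rw [e1, ← Submodule.Quotient.mk_smul, Algebra.smul_def, hc]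
    congr 1
    ring
  refine ⟨algebraMap A K b * z, ?_, ?_⟩
  · rw [Submodule.mem_div_iff_forall_mul_mem]
    intro n hn
    rw [mul_comm, ← Submodule.Quotient.mk_eq_zero, ← key n (h.le hn),
      (Submodule.Quotient.mk_eq_zero N).2 hn, map_zero]
  · rw [← Submodule.Quotient.eq, ← key y hy, hg]

variable [IsNoetherianRing A]

/-- The dual of `X` lies between `𝔪 = 1 : (1 : 𝔪)` and `A`, so it is either `𝔪` or contains a unit.
-/
theorem eq_one_or_eq_of_reflexive (hA : IsLocalRing.maximalIdeal A ≠ ⊥)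
    (hr : ∀ M : Submodule A K, IsLattice M → 1 / (1 / M) = M) {X : Submodule A K}
    (h1 : 1 ≤ X) (h2 : X ≤ 1 / maxSubmodule A K) : X = 1 ∨ X = 1 / maxSubmodule A K := by
  have hm := isLattice_maxSubmodule (A := A) (K := K) hA
  have hX : IsLattice X := (IsLattice.one.div hm).of_le
    (fun h => IsLattice.one.ne_bot (le_bot_iff.1 (h1.trans h.le))) h2
  have h3 : maxSubmodule A K ≤ 1 / X := by
    have := div_le_div_left h2 1
    rwa [hr _ hm] at this
  by_cases h4 : 1 / X ≤ maxSubmodule A K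
  · right
    rw [← hr X hX, le_antisymm h4 h3]
  · left
    obtain ⟨u, hu, hum⟩ := SetLike.not_le_iff_exists.1 h4
    have hu1 : u ∈ (1 : Submodule A K) := by
      have := div_le_div_left h1 1 hu
      rwa [div_one'] at this
    obtain ⟨a, rfl⟩ := Submodule.mem_one.1 hu1
    have ha : IsUnit a := by
      by_contra ha
      exact hum ((IsLocalization.mem_coeSubmodule K _).2
        ⟨a, (IsLocalRing.mem_maximalIdeal a).2 ha, rfl⟩)
    have h5 : (1 : K) ∈ 1 / X := by
      rw [← Submodule.smul_mem_iff_of_isUnit _ ha, Algebra.smul_def, mul_one]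
      exact hu
    exact le_antisymm (Submodule.one_mem_div.1 h5) h1

variable [Ring.KrullDimLE 1 A]

/-- A one-dimensional Noetherian local domain of finite injective dimension has type one. -/
theorem quotLength_one_div_maxSubmodule_le_one (hA : IsLocalRing.maximalIdeal A ≠ ⊥)
    (h : ∃ n : ℕ, HasInjectiveDimensionLT (ModuleCat.of A A) n) :
    quotLength (1 / maxSubmodule A K) 1 ≤ 1 := by
  obtain ⟨n, hn⟩ := h
  have hK := injective_fractionField (A := A) K
  -- The bound is raised to `n + 2` so that the dimension shift leaves the positive bound `n + 1`
  -- for `K/A`.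
  have h1 : HasInjectiveDimensionLT (ModuleCat.of A (1 : Submodule A K)) (n + 2) := by
    have : HasInjectiveDimensionLT (ModuleCat.of A A) (n + 2) :=
      hasInjectiveDimensionLT_of_ge _ n (n + 2) (by lia)
    exact hasInjectiveDimensionLT_of_iso (equivOne A K).toModuleIso (n + 2)
  have hD := ((isDivisible_of_injective (A := A) K).quotient
    1).injective_of_hasInjectiveDimensionLT hA n _ (hasInjectiveDimensionLT_quotient 1 n h1)
  by_contra! hlt
  obtain ⟨b, hb, hb0⟩ := (IsLocalRing.maximalIdeal A).ne_bot_iff.1 hA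
  have hbK : algebraMap A K b ≠ 0 := by simpa using hb0
  have hs := IsLattice.span_singleton (A := A) hbK
  have hle : Submodule.span A {algebraMap A K b} ≤ 1 :=
    (Submodule.span_singleton_le_iff_mem _ _).2 (Submodule.mem_one.2 ⟨b, rfl⟩)
  have hone := IsLattice.one (A := A) (K := K)
  -- If the type were at least two, each minimal step `N ⋖ M` would lower the degree of the dual by
  -- at least 2, while `deg M` rises by 1. For `bA ⊂ A` with `b ∈ 𝔪` both degrees change by the same
  -- positive amount, a contradiction.
  have key := le_of_forall_covBy (fun M : Submodule A K => - (deg (1 / M) + 2 * deg M))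
    (fun M N hM hN hc => by
      have h1 := hlt.trans_le (quotLength_one_div_ge_of_covBy hM hc)
      have h2 : 2 ≤ (quotLength (1 / N) (1 / M)).toNat := by
        rw [← ENat.natCast_toNat ((hone.div hN).quotLength_ne_top (hone.div hM))] at h1
        exact_mod_cast h1
      have e1 := toNat_quotLength (hone.div hN) (hone.div hM) (div_le_div_left hc.le 1)
      have e2 := toNat_quotLength hM hN hc.le
      rw [quotLength_eq_one_of_covBy hc] at e2
      simp only [ENat.toNat_one, Nat.cast_one] at e2
      lia) hone hs hle
  have e1 := div_span_singleton_mul hbK (1 : Submodule A K) 1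
  rw [mul_one, div_one', mul_one] at e1
  have e2 := deg_span_singleton_mul (inv_ne_zero hbK) hs
  rw [span_singleton_inv_mul_span_singleton A hbK, deg_one] at e2
  have e3 : deg (Submodule.span A {algebraMap A K b}) < deg (1 : Submodule A K) := by
    refine deg_lt hone hs (lt_of_le_of_ne hle fun h => ?_)
    have h1 : (1 : K) ∈ Submodule.span A {algebraMap A K b} := by
      rw [h]; exact Submodule.one_le.1 le_rfl
    obtain ⟨c, hc⟩ := Submodule.mem_span_singleton.1 h1
    rw [Algebra.smul_def, ← map_mul, ← map_one (algebraMap A K)] at hc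
    have := IsFractionRing.injective A K hc
    exact (IsLocalRing.mem_maximalIdeal b).1 hb (IsUnit.of_mul_eq_one_right c this)
  simp only [div_one', deg_one, e1] at key e3
  lia

/-- If every lattice is reflexive, then `K / A` is injective. -/
theorem injective_quotient_one_of_reflexive (hA : IsLocalRing.maximalIdeal A ≠ ⊥)
    (hr : ∀ M : Submodule A K, IsLattice M → 1 / (1 / M) = M) :
    Module.Injective A (K ⧸ (1 : Submodule A K)) := by
  refine Module.Baer.injective fun J f => ?_
  by_cases hJ : J = ⊥
  · subst hJ
    refine ⟨0, fun a ha => ?_⟩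
    have : (⟨a, ha⟩ : (⊥ : Ideal A)) = 0 := Subtype.ext ((Submodule.mem_bot A).1 ha)
    rw [this, map_zero, LinearMap.zero_apply]
  -- `S y` is the part of `J` on which `f` is multiplication by `y` modulo `A`. A maximal `S y` is
  -- shown to be all of `J`.
  let S : K → Submodule A J := fun y => LinearMap.eqLocus f
    ((Submodule.mkQ 1).comp ((LinearMap.toSpanSingleton A K y).comp J.subtype))
  have hS : ∀ y (j : J), j ∈ S y ↔ f j = Submodule.Quotient.mk ((j : A) • y) := fun y j => Iff.rfl
  obtain ⟨-, ⟨y, rfl⟩, hmax⟩ := set_has_maximal_iff_noetherian.2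
    (inferInstance : IsNoetherian A J) (Set.range S) (Set.range_nonempty S)
  replace hmax : ∀ y', ¬ S y < S y' := fun y' => hmax _ ⟨y', rfl⟩
  suffices hy : S y = ⊤ by
    refine ⟨LinearMap.toSpanSingleton A _ (Submodule.Quotient.mk y), fun a ha => ?_⟩
    have := (hS y ⟨a, ha⟩).1 (hy ▸ Submodule.mem_top)
    rw [this]
    rfl
  by_contra hy
  have hne : S y ≠ ⊥ := by
    intro h0
    obtain ⟨b, hb, hb0⟩ := J.ne_bot_iff.1 hJ
    obtain ⟨c, hc⟩ := Submodule.Quotient.mk_surjective _ (f ⟨b, hb⟩)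
    have hbK : algebraMap A K b ≠ 0 := by simpa using hb0
    refine hmax (c / algebraMap A K b) ?_
    rw [h0, bot_lt_iff_ne_bot, Submodule.ne_bot_iff]
    refine ⟨⟨b, hb⟩, ?_, fun h => hb0 (congrArg Subtype.val h)⟩
    rw [hS, ← hc, Algebra.smul_def, mul_div_cancel₀ _ hbK]
  obtain ⟨b, hb, hb0⟩ := (S y).ne_bot_iff.1 hne
  have hnt : Nontrivial (J ⧸ S y) := Submodule.Quotient.nontrivial_iff.2 hy
  obtain ⟨a, ha, ham⟩ := exists_torsionOf_eq_maximalIdeal (X := J ⧸ S y) (b := (b : A))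
    (fun h => hb0 (Subtype.ext h)) fun x => by
      obtain ⟨x, rfl⟩ := Submodule.Quotient.mk_surjective _ x
      rw [← Submodule.Quotient.mk_smul, Submodule.Quotient.mk_eq_zero]
      have : (b : A) • x = (x : A) • b := Subtype.ext (mul_comm _ _)
      rw [this]
      exact (S y).smul_mem _ hb
  obtain ⟨a, rfl⟩ := Submodule.Quotient.mk_surjective _ a
  have haS : a ∉ S y := fun h => ha ((Submodule.Quotient.mk_eq_zero _).2 h)
  have hma : ∀ r ∈ IsLocalRing.maximalIdeal A, r • a ∈ S y := fun r hr => by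
    rw [← ham, Ideal.mem_torsionOf_iff, ← Submodule.Quotient.mk_smul,
      Submodule.Quotient.mk_eq_zero] at hr
    exact hr
  let φ : J →ₗ[A] K := (Algebra.linearMap A K).comp J.subtype
  have hφ : Function.Injective φ := (IsFractionRing.injective A K).comp Subtype.val_injective
  have hM : IsLattice ((S y).map φ) := by
    refine ⟨fun h => hne ?_, Submodule.FG.map φ (IsNoetherian.noetherian _)⟩
    exact Submodule.map_injective_of_injective hφ (h.trans (Submodule.map_bot φ).symm)
  have haK : φ a ≠ 0 := fun h => haS (by rw [hφ (h.trans (map_zero φ).symm)]; exact zero_mem _)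
  have hM' := hM.sup (IsLattice.span_singleton (A := A) haK)
  -- Reflexivity separates the lattices `S y` and `S y + Aa` by their duals. The resulting `z`
  -- changes the multiplier at `a` modulo `A` without changing it on `S y`.
  obtain ⟨z, hz, hza⟩ : ∃ z ∈ 1 / (S y).map φ, φ a * z ∉ (1 : Submodule A K) := by
    by_contra! hcon
    have hle : 1 / (S y).map φ ≤ 1 / ((S y).map φ ⊔ Submodule.span A {φ a}) :=
      fun z hz => mem_div_sup_span_singleton.2 ⟨hz, hcon z hz⟩
    have h1 := div_le_div_left hle 1
    rw [hr _ hM, hr _ hM'] at h1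
    obtain ⟨s, hs, hsa⟩ := h1 (Submodule.mem_sup_right (Submodule.mem_span_singleton_self _))
    exact haS (hφ hsa ▸ hs)
  have hzm : φ a * z ∈ 1 / maxSubmodule A K := by
    rw [mem_div_maxSubmodule]
    intro r hr
    rw [mul_comm, ← mul_smul_comm, ← map_smul]
    exact Submodule.mem_div_iff_forall_mul_mem.1 hz _ ⟨_, hma r hr, rfl⟩
  have hsup : 1 ⊔ Submodule.span A {φ a * z} = 1 / maxSubmodule A K := by
    have hm1 : (1 : Submodule A K) ≤ 1 / maxSubmodule A K := by
      intro w hw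
      rw [mem_div_maxSubmodule]
      exact fun r _ => Submodule.smul_mem _ r hw
    refine (eq_one_or_eq_of_reflexive hA hr le_sup_left (sup_le hm1
      ((Submodule.span_singleton_le_iff_mem _ _).2 hzm))).resolve_left fun h => hza ?_
    rw [← h]
    exact Submodule.mem_sup_right (Submodule.mem_span_singleton_self _)
  obtain ⟨w, hw⟩ := Submodule.Quotient.mk_surjective _
    (f a - Submodule.Quotient.mk ((a : A) • y))
  have hwm : w ∈ 1 / maxSubmodule A K := by
    rw [mem_div_maxSubmodule]
    intro r hr
    rw [← Submodule.Quotient.mk_eq_zero, Submodule.Quotient.mk_smul, hw, smul_sub, ← map_smul,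
      (hS y _).1 (hma r hr), ← Submodule.Quotient.mk_smul, sub_eq_zero]
    congr 1
    exact mul_smul r (a : A) y
  rw [← hsup] at hwm
  obtain ⟨β, hβ, v, hv, rfl⟩ := Submodule.mem_sup.1 hwm
  obtain ⟨α, rfl⟩ := Submodule.mem_span_singleton.1 hv
  -- The error `f a - ay` lies in `(1 : 𝔪)/1`, which `az` generates, so it is the class of `α a z`;
  -- replacing `y` by `y + αz` absorbs it and adds `a` to the locus.
  refine hmax (y + α • z) (lt_of_le_of_ne (fun j hj => ?_) fun h => haS ?_)
  · rw [hS, (hS y j).1 hj, Submodule.Quotient.eq, smul_add, sub_add_cancel_left,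
      Submodule.neg_mem_iff, smul_comm]
    refine Submodule.smul_mem _ _ ?_
    rw [Algebra.smul_def, mul_comm]
    exact Submodule.mem_div_iff_forall_mul_mem.1 hz _ ⟨j, hj, rfl⟩
  · rw [h, hS, ← sub_add_cancel (f a) (Submodule.Quotient.mk ((a : A) • y)), ← hw,
      ← Submodule.Quotient.mk_add, Submodule.Quotient.eq]
    have : β + α • (φ a * z) + (a : A) • y - (a : A) • (y + α • z) = β := by
      have : φ a = algebraMap A K a := rfl
      rw [this]
      simp only [Algebra.smul_def]
      ring
    rwa [this]

theorem hasInjectiveDimensionLT_two_of_reflexive (K : Type u) [Field K] [Algebra A K]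
    [IsFractionRing A K] (hA : IsLocalRing.maximalIdeal A ≠ ⊥)
    (hr : ∀ M : Submodule A K, IsLattice M → 1 / (1 / M) = M) :
    HasInjectiveDimensionLT (ModuleCat.of A A) 2 := by
  have hK := injective_fractionField (A := A) K
  have := injective_quotient_one_of_reflexive hA hr
  have := hasInjectiveDimensionLT_two_of_quotient (1 : Submodule A K)
  exact hasInjectiveDimensionLT_of_iso (equivOne A K).symm.toModuleIso 2

end Gorenstein

/-! ### Canonical modules have type one -/

section Canonical

variable {A : Type u} [CommRing A] [IsLocalRing A] {K : Type u} [Field K]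
  [Algebra A K] [IsFractionRing A K]

/-- Multiplication by an element of `W : 𝔪`, as a linear map `𝔪 → W`. -/
noncomputable def maximalIdealMul (W : Submodule A K) :
    ↥(W / maxSubmodule A K) →ₗ[A] IsLocalRing.maximalIdeal A →ₗ[A] W :=
  LinearMap.mk₂ A (fun z a => ⟨(a : A) • (z : K), mem_div_maxSubmodule.1 z.2 a a.2⟩)
    (fun _ _ _ => Subtype.ext (smul_add _ _ _))
    (fun _ _ _ => Subtype.ext (smul_comm _ _ _))
    (fun _ _ _ => Subtype.ext (add_smul _ _ _))
    (fun _ _ _ => Subtype.ext (mul_smul _ _ _))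

open Abelian in
/-- The connecting map `W : 𝔪 → Ext¹(k, W)`. -/
noncomputable def connecting (W : Submodule A K) :
    ↥(W / maxSubmodule A K) →ₗ[A] Ext (ModuleCat.of A (IsLocalRing.ResidueField A))
      (ModuleCat.of A W) 1 where
  toFun z := (shortExact_subtype_mkQ (IsLocalRing.maximalIdeal A)).extClass.comp
    (Ext.mk₀ (ModuleCat.ofHom (maximalIdealMul W z))) (add_zero 1)
  map_add' z z' := by
    rw [map_add, ModuleCat.ofHom_add, Ext.mk₀_add, Ext.comp_add]
    rfl
  map_smul' c z := by
    have h : ModuleCat.ofHom (maximalIdealMul W (c • z)) =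
        c • ModuleCat.ofHom (maximalIdealMul W z) := by
      rw [map_smul]
      rfl
    rw [h, Ext.mk₀_smul, Ext.comp_smul]
    rfl

-- If the class vanishes, multiplication by `z` extends from `𝔪` to a map `A → W`; that map is
-- multiplication by its value at `1`, which must be `z`. Thus `(W : 𝔪)/W` has length at most that
-- of `Ext¹(k, W)`.
open Abelian in
theorem mem_of_connecting_eq_zero (hA : IsLocalRing.maximalIdeal A ≠ ⊥) (W : Submodule A K)
    (z : ↥(W / maxSubmodule A K)) (hz : connecting W z = 0) : (z : K) ∈ W := by
  obtain ⟨x, hx⟩ := Ext.contravariant_sequence_exact₁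
    (shortExact_subtype_mkQ (IsLocalRing.maximalIdeal A)) (ModuleCat.of A W) _ (add_zero 1) hz
  obtain ⟨g, rfl⟩ := Ext.homEquiv₀.symm.surjective x
  have hg : ModuleCat.ofHom (IsLocalRing.maximalIdeal A).subtype ≫ g =
      ModuleCat.ofHom (maximalIdealMul W z) :=
    Ext.homEquiv₀.symm.injective (by simpa using hx)
  obtain ⟨b, hb, hb0⟩ := (IsLocalRing.maximalIdeal A).ne_bot_iff.1 hA
  have h1 : g.hom b = maximalIdealMul W z ⟨b, hb⟩ :=
    congrArg (fun t => t.hom ⟨b, hb⟩) hg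
  have h2 : g.hom b = b • g.hom (1 : A) := by
    rw [← map_smul, smul_eq_mul, mul_one]
  have h3 : b • ((g.hom (1 : A) : W) : K) = b • (z : K) :=
    congrArg Subtype.val (h2.symm.trans h1)
  have hbK : algebraMap A K b ≠ 0 := by simpa using hb0
  rw [Algebra.smul_def, Algebra.smul_def] at h3
  rw [← mul_left_cancel₀ hbK h3]
  exact (g.hom (1 : A) : W).2

/-- A canonical module, as a lattice, has type one. -/
theorem quotLength_div_maxSubmodule_le_one (hA : IsLocalRing.maximalIdeal A ≠ ⊥)
    {W : Submodule A K} (hW : IsCanonicalModule A 1 W) :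
    quotLength (W / maxSubmodule A K) W ≤ 1 := by
  obtain ⟨e⟩ := hW.ext_equiv
  let f := e.toLinearMap.comp (connecting W)
  have hker : LinearMap.ker f ≤ W.submoduleOf (W / maxSubmodule A K) := fun z hz =>
    mem_of_connecting_eq_zero hA W z (e.map_eq_zero_iff.1 hz)
  have h1 : Module.length A (↥(W / maxSubmodule A K) ⧸ LinearMap.ker f) ≤
      Module.length A (IsLocalRing.ResidueField A) :=
    Module.length_le_of_injective ((LinearMap.ker f).liftQ f le_rfl)
      (LinearMap.ker_eq_bot.1 (Submodule.ker_liftQ_eq_bot _ _ _ le_rfl))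
  have h2 : Module.length A (IsLocalRing.ResidueField A) = 1 := by
    have : IsSimpleModule A (IsLocalRing.ResidueField A) :=
      isSimpleModule_iff_isCoatom.2 (IsLocalRing.maximalIdeal.isMaximal A).out
    exact Module.length_eq_one _ _
  refine le_trans ?_ (h1.trans h2.le)
  exact Module.length_le_of_surjective (Submodule.factor hker) (Submodule.factor_surjective hker)

end Canonical

/-! ### Overrings and their duals -/

section Overring

variable {R : Type u} [CommRing R] {K : Type u} [Field K] [Algebra R K]

theorem isFractionRing_subalgebra [IsDomain R] [IsFractionRing R K] (L : Subalgebra R K) :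
    IsFractionRing L K := by
  refine IsFractionRing.of_field L K fun z => ?_
  obtain ⟨a, b, hb, rfl⟩ := IsFractionRing.div_surjective (A := R) z
  exact ⟨algebraMap R L a, algebraMap R L b, rfl⟩

/-- An injective integral ring map reflects units, so locality passes from the integral closure down
to `L`. -/
theorem isLocalRing_of_le_integralClosure [IsLocalRing (integralClosure R K)]
    {L : Subalgebra R K} (hL : L ≤ integralClosure R K) : IsLocalRing L := by
  have hint : (Subalgebra.inclusion hL).toRingHom.IsIntegral := by
    rintro ⟨y, hy⟩
    have h1 : IsIntegral R (⟨y, hy⟩ : integralClosure R K) :=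
      (isIntegral_algHom_iff (integralClosure R K).val Subtype.val_injective).1 hy
    obtain ⟨p, hp, hp'⟩ := h1
    refine ⟨p.map (algebraMap R L), hp.map _, ?_⟩
    rw [Polynomial.eval₂_map]
    exact hp'
  have := hint.isLocalHom (Subalgebra.inclusion_injective hL)
  exact (Subalgebra.inclusion hL).toRingHom.domain_isLocalRing

theorem krullDimLE_one_of_isIntegral [IsDomain R] [Ring.KrullDimLE 1 R] (L : Subalgebra R K)
    [Algebra.IsIntegral R L] : Ring.KrullDimLE 1 L := by
  rw [Ring.krullDimLE_one_iff_of_noZeroDivisors]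
  intro p hp hprime
  obtain ⟨y, hy, hy0⟩ := p.ne_bot_iff.1 hp
  have h1 : p.comap (algebraMap R L) ≠ ⊥ :=
    Ideal.comap_ne_bot_of_integral_mem hy0 hy (Algebra.IsIntegral.isIntegral y)
  have h2 : (p.comap (algebraMap R L)).IsMaximal :=
    (hprime.comap (algebraMap R L)).isMaximal_of_ne_bot h1
  exact Ideal.isMaximal_of_isIntegral_of_isMaximal_comap p h2

theorem maximalIdeal_ne_bot_of_isIntegral [IsLocalRing R] [FaithfulSMul R K]
    (L : Subalgebra R K) [Algebra.IsIntegral R L] [IsLocalRing L]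
    (hR : IsLocalRing.maximalIdeal R ≠ ⊥) : IsLocalRing.maximalIdeal L ≠ ⊥ := by
  obtain ⟨b, hb, hb0⟩ := (IsLocalRing.maximalIdeal R).ne_bot_iff.1 hR
  have hinj : Function.Injective (algebraMap R L) := fun a b hab =>
    FaithfulSMul.algebraMap_injective R K (congrArg Subtype.val hab)
  have : FaithfulSMul R L := (faithfulSMul_iff_algebraMap_injective R L).2 hinj
  refine (Submodule.ne_bot_iff _).2 ⟨algebraMap R L b, ?_, fun h => hb0 ?_⟩
  · rw [IsLocalRing.mem_maximalIdeal]
    exact fun hu => (IsLocalRing.mem_maximalIdeal b).1 hb (hu.of_map (algebraMap R L) b)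
  · exact hinj (h.trans (map_zero _).symm)

variable {L : Subalgebra R K}

theorem restrictScalars_div (M N : Submodule L K) :
    (M / N).restrictScalars R = M.restrictScalars R / N.restrictScalars R := by
  ext z
  simp only [Submodule.restrictScalars_mem, Submodule.mem_div_iff_forall_mul_mem]

theorem restrictScalars_one :
    (1 : Submodule L K).restrictScalars R = Subalgebra.toSubmodule L := by
  ext z
  rw [Submodule.restrictScalars_mem, Submodule.mem_one, Subalgebra.mem_toSubmodule]
  exact ⟨fun ⟨l, hl⟩ => hl ▸ l.2, fun h => ⟨⟨z, h⟩, rfl⟩⟩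

theorem toSubmodule_mul_restrictScalars (M : Submodule L K) :
    Subalgebra.toSubmodule L * M.restrictScalars R = M.restrictScalars R := by
  refine le_antisymm (Submodule.mul_le.2 fun l hl m hm => ?_) fun m hm => ?_
  · exact M.smul_mem (⟨l, hl⟩ : L) hm
  · rw [← one_mul m]
    exact Submodule.mul_mem_mul L.one_mem hm

theorem IsLattice.restrictScalars [Module.Finite R L] {M : Submodule L K} (hM : IsLattice M) :
    IsLattice (M.restrictScalars R) :=
  ⟨fun h => hM.ne_bot ((Submodule.restrictScalars_eq_bot_iff R L K).1 h), hM.fg.restrictScalars⟩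

/-- The colon `W : M` of an `R`-module by an overring module is a module over the overring. -/
def overColon (W : Submodule R K) (M : Submodule L K) : Submodule L K where
  carrier := {z | ∀ m ∈ M, z * m ∈ W}
  add_mem' ha hb m hm := by rw [add_mul]; exact W.add_mem (ha m hm) (hb m hm)
  zero_mem' m _ := by rw [zero_mul]; exact W.zero_mem
  smul_mem' l z hz m hm := by
    rw [smul_mul_assoc, ← mul_smul_comm]
    exact hz _ (M.smul_mem l hm)

theorem restrictScalars_overColon (W : Submodule R K) (M : Submodule L K) :
    (overColon W M).restrictScalars R = W / M.restrictScalars R := by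
  ext z
  rw [Submodule.mem_div_iff_forall_mul_mem]
  rfl

/-- If the dual of `L` is isomorphic to `L`, then all `L`-lattices are reflexive. -/
theorem reflexive_of_div_eq [Module.Finite R L] {W : Submodule R K}
    (hW : ∀ M : Submodule R K, IsLattice M → W / (W / M) = M) {y : K} (hy : y ≠ 0)
    (h : W / Subalgebra.toSubmodule L = Submodule.span R {y} * Subalgebra.toSubmodule L)
    (M : Submodule L K) (hM : IsLattice M) : 1 / (1 / M) = M := by
  -- Since `(W : L) : N = W : LN = W : N`, duals into `L` and into `W` differ by the factor `y`,
  -- which cancels in the double dual.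
  have key : ∀ N : Submodule L K, Subalgebra.toSubmodule L / N.restrictScalars R =
      Submodule.span R {y⁻¹} * (W / N.restrictScalars R) := by
    intro N
    have h1 := span_singleton_mul_div hy (Subalgebra.toSubmodule L) (N.restrictScalars R)
    rw [← h, ← div_mul_eq_div_div, toSubmodule_mul_restrictScalars] at h1
    rw [h1, ← mul_assoc, span_singleton_inv_mul_span_singleton R hy, one_mul]
  refine Submodule.restrictScalars_injective R L K ?_
  rw [restrictScalars_div, restrictScalars_one, key, restrictScalars_div, restrictScalars_one, key,
    div_span_singleton_mul (inv_ne_zero hy), inv_inv, ← mul_assoc,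
    span_singleton_inv_mul_span_singleton R hy, one_mul, hW _ hM.restrictScalars]

/-- If `L` has type one, then its dual is isomorphic to `L`. -/
theorem exists_div_eq_of_type_one [IsDomain R] [IsNoetherianRing R] [IsFractionRing R K]
    [Module.Finite R L] [IsLocalRing L] (hLm : IsLocalRing.maximalIdeal L ≠ ⊥)
    {W : Submodule R K} (hWl : IsLattice W)
    (hW : ∀ M : Submodule R K, IsLattice M → W / (W / M) = M)
    (ht : quotLength (1 / maxSubmodule L K) (1 : Submodule L K) ≤ 1) :
    ∃ y : K, y ≠ 0 ∧
      W / Subalgebra.toSubmodule L = Submodule.span R {y} * Subalgebra.toSubmodule L := by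
  have hLl : IsLattice (Subalgebra.toSubmodule L) := by
    rw [← restrictScalars_one]
    exact IsLattice.one.restrictScalars
  let N : Submodule L K := overColon W 1
  have hN : N.restrictScalars R = W / Subalgebra.toSubmodule L := by
    rw [restrictScalars_overColon, restrictScalars_one]
  have hNl : IsLattice (N.restrictScalars R) := hN ▸ hWl.div hLl
  have hNfg : N.FG := hNl.fg.of_restrictScalars R
  have hWN : W / N.restrictScalars R = Subalgebra.toSubmodule L := by rw [hN, hW _ hLl]
  let P : Submodule L K := IsLocalRing.maximalIdeal L • N
  have hPN : P ≤ N := Submodule.smul_le_right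
  have hJ : IsLocalRing.maximalIdeal L ≤ (⊥ : Ideal L).jacobson :=
    (IsLocalRing.jacobson_eq_maximalIdeal ⊥ bot_ne_top).ge
  obtain ⟨y, hyN, hyP⟩ : ∃ y ∈ N, y ∉ P := by
    by_contra! hcon
    refine hNl.ne_bot ?_
    rw [Submodule.eq_bot_of_le_smul_of_le_jacobson_bot _ N hNfg hcon hJ]
    exact Submodule.restrictScalars_bot R L K
  have hy0 : y ≠ 0 := fun h => hyP (h ▸ P.zero_mem)
  -- `P' = Ly + 𝔪N` lies between `𝔪N` and `N = W : L`, so its dual into `W` lies between `L` and `L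
  -- : 𝔪`. Type one leaves the two ends: `L` gives `P' = N`, and `N = Ly` by Nakayama; `L : 𝔪` would
  -- give `P' = 𝔪N`, against `y ∉ 𝔪N`.
  let P' : Submodule L K := Submodule.span L {y} ⊔ P
  have hyP' : y ∈ P' := Submodule.mem_sup_left (Submodule.mem_span_singleton_self y)
  have hP'N : P' ≤ N := sup_le ((Submodule.span_singleton_le_iff_mem _ _).2 hyN) hPN
  have hP'l : IsLattice (P'.restrictScalars R) :=
    hNl.of_le (fun h => hy0 ((Submodule.mem_bot R).1 (h ▸ hyP'))) hP'N
  have hPl : IsLattice (P.restrictScalars R) := by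
    obtain ⟨b, hb, hb0⟩ := (IsLocalRing.maximalIdeal L).ne_bot_iff.1 hLm
    have hby : b • y ∈ P := Submodule.smul_mem_smul hb hyN
    exact hNl.of_le (fun h => smul_ne_zero hb0 hy0 ((Submodule.mem_bot R).1 (h ▸ hby))) hPN
  have hXm : ∀ z ∈ overColon W P, z ∈ 1 / maxSubmodule L K := by
    intro z hz
    rw [mem_div_maxSubmodule]
    intro a ha
    have : a • z ∈ (1 : Submodule L K).restrictScalars R := by
      rw [restrictScalars_one, ← hWN, Submodule.mem_div_iff_forall_mul_mem]
      intro n hn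
      rw [smul_mul_assoc, ← mul_smul_comm]
      exact hz _ (Submodule.smul_mem_smul ha hn)
    exact this
  have hanti : overColon W P' ≤ overColon W P := fun z hz m hm =>
    hz m (Submodule.mem_sup_right hm)
  have h1X : 1 ≤ overColon W P' := by
    intro z hz p hp
    have := hP'N hp z hz
    rwa [mul_comm] at this
  have hNP' : P' = N := by
    refine Submodule.restrictScalars_injective R L K ?_
    rcases eq_or_eq_of_quotLength_le_one ht h1X (fun z hz => hXm z (hanti hz)) with h | h
    · rw [← hW _ hP'l, ← restrictScalars_overColon, h, restrictScalars_one, hN]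
    · exfalso
      have heq : overColon W P' = overColon W P :=
        le_antisymm hanti fun z hz => h ▸ hXm z hz
      have hPP' : P.restrictScalars R = P'.restrictScalars R := by
        rw [← hW _ hPl, ← restrictScalars_overColon W P, ← heq, restrictScalars_overColon,
          hW _ hP'l]
      have : y ∈ P.restrictScalars R := hPP' ▸ hyP'
      exact hyP this
  have hNy : N = Submodule.span L {y} := le_antisymm
    (Submodule.le_of_le_smul_of_le_jacobson_bot hNfg hJ hNP'.ge)
    ((Submodule.span_singleton_le_iff_mem _ _).2 hyN)
  refine ⟨y, hy0, ?_⟩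
  rw [← hN, hNy]
  ext z
  rw [Submodule.restrictScalars_mem, Submodule.mem_span_singleton,
    Submodule.mem_span_singleton_mul]
  constructor
  · rintro ⟨l, rfl⟩
    exact ⟨l, l.2, mul_comm _ _⟩
  · rintro ⟨l, hl, rfl⟩
    exact ⟨⟨l, hl⟩, mul_comm _ _⟩

end Overring

/-! ### Minimal reductions and the blowing-up -/

section Reduction

variable {R : Type u} [CommRing R] {K : Type u} [Field K] [Algebra R K]

theorem pow_succ_eq_of_reductionExponent_le {I : Ideal R} {x : R} (hx : IsMinimalReduction I x)
    {n : ℕ} (hn : reductionExponent I x ≤ n) : I ^ (n + 1) = Ideal.span {x} * I ^ n :=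
  Nat.sInf_mem (s := {m : ℕ | ∀ n ≥ m, I ^ (n + 1) = Ideal.span {x} * I ^ n}) hx.2 n hn

theorem IsMinimalReduction.ne_zero [IsDomain R] {I : Ideal R} {x : R}
    (hx : IsMinimalReduction I x) (hI : I ≠ ⊥) : x ≠ 0 := by
  rintro rfl
  have h := pow_succ_eq_of_reductionExponent_le hx le_rfl
  rw [Ideal.span_singleton_zero, Ideal.bot_mul] at h
  exact pow_ne_zero _ hI h

theorem idealPow_add (I : Ideal R) (m n : ℕ) :
    idealPow K I (m + n) = idealPow K I m * idealPow K I n := by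
  rw [idealPow, pow_add, IsLocalization.coeSubmodule_mul]
  rfl

theorem idealPow_zero (I : Ideal R) : idealPow K I 0 = 1 := by
  rw [idealPow, pow_zero, Ideal.one_eq_top, IsLocalization.coeSubmodule_top]

theorem idealPow_add_eq_span_pow_mul {I : Ideal R} {x : R} (hx : IsMinimalReduction I x)
    {n : ℕ} (hn : reductionExponent I x ≤ n) (m : ℕ) :
    idealPow K I (n + m) = Submodule.span R {algebraMap R K x ^ m} * idealPow K I n := by
  induction m with
  | zero => rw [add_zero, pow_zero, ← Submodule.one_eq_span, one_mul]
  | succ m ih =>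
    rw [← add_assoc, idealPow, pow_succ_eq_of_reductionExponent_le hx (by lia),
      IsLocalization.coeSubmodule_mul, IsLocalization.coeSubmodule_span_singleton, pow_succ',
      ← Set.singleton_mul_singleton, ← Submodule.span_mul_span, mul_assoc, ← ih]
    rfl

theorem pow_mem_idealPow {I : Ideal R} {x : R} (hx : x ∈ I) (n : ℕ) :
    algebraMap R K x ^ n ∈ idealPow K I n :=
  (IsLocalization.mem_coeSubmodule K _).2 ⟨x ^ n, Ideal.pow_mem_pow hx n, map_pow _ _ _⟩

/-- The blowing-up is `x⁻ⁿ Iⁿ` for `n` at least the reduction exponent. -/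
theorem span_pow_mul_blowup [FaithfulSMul R K] {I : Ideal R} {x : R}
    (hx : IsMinimalReduction I x) (hx0 : x ≠ 0) :
    Submodule.span R {algebraMap R K x ^ reductionExponent I x} *
      Subalgebra.toSubmodule (blowup K I) = idealPow K I (reductionExponent I x) := by
  have hxK : algebraMap R K x ≠ 0 := by
    rwa [Ne, FaithfulSMul.algebraMap_eq_zero_iff]
  set ν := reductionExponent I x with hν
  apply le_antisymm
  · intro w hw
    obtain ⟨z, hz, rfl⟩ := Submodule.mem_span_singleton_mul.1 hw
    obtain ⟨n, hn⟩ := Set.mem_iUnion.1 (show z ∈ ⋃ n : ℕ,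
      ((idealPow K I n / idealPow K I n : Submodule R K) : Set K) from hz)
    have hn' := div_idealPow_mono I (le_max_left n ν) hn
    obtain ⟨k, hk⟩ := Nat.exists_eq_add_of_le (le_max_right n ν)
    -- With `n = ν + k`, the product `z xⁿ` lies in `Iⁿ = xᵏIᵛ`; cancelling `xᵏ` gives `xᵛz ∈ Iᵛ`.
    have h1 : z * algebraMap R K x ^ (ν + k) ∈ idealPow K I (ν + k) := by
      rw [← hk]
      exact Submodule.mem_div_iff_forall_mul_mem.1 hn' _ (pow_mem_idealPow hx.1 _)
    rw [idealPow_add_eq_span_pow_mul hx le_rfl, Submodule.mem_span_singleton_mul] at h1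
    obtain ⟨v, hv, hvz⟩ := h1
    have : algebraMap R K x ^ ν * z = v := by
      refine mul_left_cancel₀ (pow_ne_zero k hxK) ?_
      rw [hvz]
      ring
    rwa [this]
  · intro w hw
    refine Submodule.mem_span_singleton_mul.2
      ⟨(algebraMap R K x ^ ν)⁻¹ * w, ?_, mul_inv_cancel_left₀ (pow_ne_zero ν hxK) w⟩
    -- For `w ∈ Iᵛ`, `w Iᵛ ⊆ I²ᵛ = xᵛIᵛ`, so `x⁻ᵛw` already lies in `Iᵛ : Iᵛ`.
    refine Set.mem_iUnion.2 ⟨ν, Submodule.mem_div_iff_forall_mul_mem.2 fun v hv => ?_⟩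
    have h1 : w * v ∈ idealPow K I (ν + ν) := by
      rw [idealPow_add]
      exact Submodule.mul_mem_mul hw hv
    rw [idealPow_add_eq_span_pow_mul hx le_rfl, Submodule.mem_span_singleton_mul] at h1
    obtain ⟨t, ht, htw⟩ := h1
    rw [mul_assoc, ← htw, inv_mul_cancel_left₀ (pow_ne_zero ν hxK)]
    exact ht

theorem hilbertLength_eq_quotLength [FaithfulSMul R K] (I : Ideal R) (n : ℕ) :
    hilbertLength I n = quotLength (idealPow K I n) (idealPow K I (n + 1)) :=
  (length_quotient_map (Algebra.linearMap R K) (FaithfulSMul.algebraMap_injective R K) (I ^ n)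
    (I ^ (n + 1))).symm

theorem isLattice_idealPow [IsDomain R] [IsNoetherianRing R] [IsFractionRing R K] {I : Ideal R}
    (hI : I ≠ ⊥) (n : ℕ) : IsLattice (idealPow K I n) := by
  refine ⟨fun h => pow_ne_zero n hI ?_, ?_⟩
  · exact IsFractionRing.coeSubmodule_injective R K
      (h.trans (IsLocalization.coeSubmodule_bot K).symm)
  · exact (IsLocalization.coeSubmodule_fg K (IsFractionRing.injective R K) _).2
      (IsNoetherian.noetherian _)

theorem isLattice_blowup [IsDomain R] [IsNoetherianRing R] [IsFractionRing R K] {I : Ideal R}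
    (hI : I ≠ ⊥) {x : R} (hx : IsMinimalReduction I x) :
    IsLattice (Subalgebra.toSubmodule (blowup K I)) := by
  have hxK : algebraMap R K x ≠ 0 := by simpa using hx.ne_zero hI
  have hp := pow_ne_zero (reductionExponent I x) hxK
  have h := span_pow_mul_blowup (K := K) hx (hx.ne_zero hI)
  have h2 : Subalgebra.toSubmodule (blowup K I) =
      Submodule.span R {(algebraMap R K x ^ reductionExponent I x)⁻¹} *
        idealPow K I (reductionExponent I x) := by
    rw [← h, ← mul_assoc, span_singleton_inv_mul_span_singleton R hp, one_mul]
  rw [h2]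
  exact (IsLattice.span_singleton (inv_ne_zero hp)).mul (isLattice_idealPow hI _)

theorem idealPow_antitone (I : Ideal R) {m n : ℕ} (h : m ≤ n) :
    idealPow K I n ≤ idealPow K I m :=
  IsLocalization.coeSubmodule_mono K (Ideal.pow_le_pow_right h)

end Reduction

/-! ### The numerator of the Hilbert series -/

section Hilbert

open Polynomial

/-- A sequence equal to `e` from `ν` on has as generating series a polynomial plus `e/(1 - z)`. This
explicit numerator has derivative `eν - ∑_{n<ν} H n` at 1. -/
theorem coe_numerator_eq (H : ℕ → ℤ) (e : ℤ) (ν : ℕ) (h : ∀ n ≥ ν, H n = e) :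
    (((1 - X) * ∑ n ∈ Finset.range ν, C (H n - e) * X ^ n + C e : ℤ[X]) : PowerSeries ℤ) =
      (1 - PowerSeries.X) * PowerSeries.mk H := by
  have h1 : PowerSeries.mk H = ((∑ n ∈ Finset.range ν, C (H n - e) * X ^ n : ℤ[X]) :
      PowerSeries ℤ) + PowerSeries.C e * PowerSeries.mk (fun _ => (1 : ℤ)) := by
    ext n
    rw [map_add, PowerSeries.coeff_mk, Polynomial.coeff_coe, PowerSeries.coeff_C_mul,
      PowerSeries.coeff_mk, Polynomial.finsetSum_coeff]
    simp only [Polynomial.coeff_C_mul_X_pow]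
    rw [Finset.sum_ite_eq]
    split_ifs with hn
    · ring
    · rw [h n (by simpa using hn)]
      ring
  have h2 : (1 - PowerSeries.X) * PowerSeries.mk (fun _ => (1 : ℤ)) = 1 := by
    rw [mul_comm]
    exact PowerSeries.mk_one_mul_one_sub_eq_one ℤ
  rw [h1, mul_add, mul_left_comm, h2, mul_one, Polynomial.coe_add,
    Polynomial.coe_mul, Polynomial.coe_sub, Polynomial.coe_one, Polynomial.coe_X, Polynomial.coe_C]

theorem eval_one_numerator (H : ℕ → ℤ) (e : ℤ) (ν : ℕ) :
    ((1 - X) * ∑ n ∈ Finset.range ν, C (H n - e) * X ^ n + C e : ℤ[X]).eval 1 = e := by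
  simp

theorem eval_one_derivative_numerator (H : ℕ → ℤ) (e : ℤ) (ν : ℕ) :
    (derivative ((1 - X) * ∑ n ∈ Finset.range ν, C (H n - e) * X ^ n + C e : ℤ[X])).eval 1 =
      e * ν - ∑ n ∈ Finset.range ν, H n := by
  simp [eval_finsetSum, mul_comm]

variable {R : Type u} [CommRing R]

theorem isHPolynomial_hPolynomial {I : Ideal R} (h : ∃ p, IsHPolynomial I p) :
    IsHPolynomial I (hPolynomial I) := by
  rw [hPolynomial, dif_pos h]
  exact h.choose_spec

theorem IsHPolynomial.hPolynomial_eq {I : Ideal R} {p : ℤ[X]} (h : IsHPolynomial I p) :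
    hPolynomial I = p :=
  Polynomial.coe_injective ℤ
    (Eq.trans (isHPolynomial_hPolynomial ⟨p, h⟩ : _ = _) (Eq.symm h))

end Hilbert

/-! ### Multiplicity and genus as degrees -/

section Invariants

variable {R : Type u} [CommRing R] [IsDomain R] [IsNoetherianRing R] [Ring.KrullDimLE 1 R]
  {K : Type u} [Field K] [Algebra R K] [IsFractionRing R K]

variable (K) in
theorem toNat_hilbertLength {I : Ideal R} (hI : I ≠ ⊥) (n : ℕ) :
    ((hilbertLength I n).toNat : ℤ) = deg (idealPow K I n) - deg (idealPow K I (n + 1)) := by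
  rw [hilbertLength_eq_quotLength (K := K), toNat_quotLength (isLattice_idealPow hI n)
    (isLattice_idealPow hI (n + 1)) (idealPow_antitone I n.le_succ)]

theorem hilbertLength_ne_top {I : Ideal R} (hI : I ≠ ⊥) (n : ℕ) : hilbertLength I n ≠ ⊤ := by
  rw [hilbertLength_eq_quotLength (K := FractionRing R)]
  exact (isLattice_idealPow hI n).quotLength_ne_top (isLattice_idealPow hI (n + 1))

variable (K) in
theorem toNat_hilbertLength_of_le {I : Ideal R} (hI : I ≠ ⊥) {x : R}
    (hx : IsMinimalReduction I x) {n : ℕ} (hn : reductionExponent I x ≤ n) :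
    ((hilbertLength I n).toNat : ℤ) = - deg (Submodule.span R {algebraMap R K x}) := by
  have hxK : algebraMap R K x ≠ 0 := by simpa using hx.ne_zero hI
  rw [toNat_hilbertLength K hI, idealPow_add_eq_span_pow_mul hx hn, pow_one,
    deg_span_singleton_mul hxK (isLattice_idealPow hI n)]
  ring

variable (K) in
theorem isHPolynomial_numerator {I : Ideal R} (hI : I ≠ ⊥) {x : R}
    (hx : IsMinimalReduction I x) :
    IsHPolynomial I ((1 - Polynomial.X) * ∑ n ∈ Finset.range (reductionExponent I x),
      Polynomial.C (((hilbertLength I n).toNat : ℤ) - -deg (Submodule.span R {algebraMap R K x})) *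
        Polynomial.X ^ n + Polynomial.C (- deg (Submodule.span R {algebraMap R K x}))) :=
  coe_numerator_eq _ _ _ fun _ hn => toNat_hilbertLength_of_le K hI hx hn

variable (K) in
theorem multiplicity_eq {I : Ideal R} (hI : I ≠ ⊥) {x : R} (hx : IsMinimalReduction I x) :
    multiplicity I = - deg (Submodule.span R {algebraMap R K x}) := by
  rw [multiplicity, (isHPolynomial_numerator K hI hx).hPolynomial_eq, eval_one_numerator]

theorem deg_idealPow_reductionExponent {I : Ideal R} (hI : I ≠ ⊥) {x : R}
    (hx : IsMinimalReduction I x) (hΛ : IsLattice (Subalgebra.toSubmodule (blowup K I))) :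
    deg (idealPow K I (reductionExponent I x)) =
      deg (Subalgebra.toSubmodule (blowup K I)) - multiplicity I * reductionExponent I x := by
  have hxK : algebraMap R K x ≠ 0 := by simpa using hx.ne_zero hI
  rw [← span_pow_mul_blowup hx (hx.ne_zero hI), deg_span_singleton_mul (pow_ne_zero _ hxK) hΛ,
    deg_span_pow hxK, multiplicity_eq K hI hx]
  ring

/-- The genus of `I` is the length of `Λ / R`. -/
theorem genus_eq_deg_blowup {I : Ideal R} (hI : I ≠ ⊥) {x : R} (hx : IsMinimalReduction I x)
    (hΛ : IsLattice (Subalgebra.toSubmodule (blowup K I))) :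
    genus I = deg (Subalgebra.toSubmodule (blowup K I)) := by
  have h1 := deg_idealPow_reductionExponent hI hx hΛ
  rw [multiplicity_eq K hI hx] at h1
  rw [genus, (isHPolynomial_numerator K hI hx).hPolynomial_eq, eval_one_derivative_numerator]
  simp only [toNat_hilbertLength K hI]
  -- The sum telescopes to `-deg Iᵛ`, the length of `R/Iᵛ`, and the terms `eν` cancel.
  rw [Finset.sum_range_sub', h1, idealPow_zero, deg_one]
  ring

end Invariants

/-! ### The Gorenstein criterion for overrings -/

section Blowup

variable {R : Type u} [CommRing R] [IsDomain R] [IsNoetherianRing R] [IsLocalRing R]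
  [Ring.KrullDimLE 1 R] {K : Type u} [Field K] [Algebra R K] [IsFractionRing R K]

/-- An overring which is a lattice has a dual isomorphic to itself if and only if it is
Gorenstein. -/
theorem isGorensteinLocalRing_iff_exists_div_eq [IsLocalRing (integralClosure R K)]
    (hR : IsLocalRing.maximalIdeal R ≠ ⊥) {L : Subalgebra R K}
    (hL : IsLattice (Subalgebra.toSubmodule L)) {W : Submodule R K} (hWl : IsLattice W)
    (hW : ∀ M : Submodule R K, IsLattice M → W / (W / M) = M) :
    IsGorensteinLocalRing L ↔ ∃ y : K, y ≠ 0 ∧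
      W / Subalgebra.toSubmodule L = Submodule.span R {y} * Subalgebra.toSubmodule L := by
  have hfin : Module.Finite R L := Module.Finite.iff_fg.2 hL.fg
  have hint : Algebra.IsIntegral R L := Algebra.IsIntegral.of_finite R L
  have hle : L ≤ integralClosure R K := fun z hz =>
    (Algebra.IsIntegral.isIntegral (R := R) (⟨z, hz⟩ : L)).map L.val
  have hloc : IsLocalRing L := isLocalRing_of_le_integralClosure hle
  have hnoeth : IsNoetherianRing L := IsNoetherianRing.of_finite R L
  have hfrac : IsFractionRing L K := isFractionRing_subalgebra L
  have hkd : Ring.KrullDimLE 1 L := krullDimLE_one_of_isIntegral L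
  have hLm : IsLocalRing.maximalIdeal L ≠ ⊥ := maximalIdeal_ne_bot_of_isIntegral L hR
  constructor
  · intro h
    exact exists_div_eq_of_type_one hLm hWl hW
      (quotLength_one_div_maxSubmodule_le_one hLm h.finite_injectiveDimension)
  · rintro ⟨y, hy, h⟩
    exact ⟨hloc, hnoeth, 2, hasInjectiveDimensionLT_two_of_reflexive K hLm
      (reflexive_of_div_eq hW hy h)⟩

end Blowup

end BlowUp

/-! ### The genus formula and its equality case -/

/-- `⊥ : Subalgebra R K` and `1 : Submodule R K` are the image of `R` in `K`, and `M / N` is the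
colon `M : N` in `K`. -/
theorem proposition3p4 {R : Type u} [CommRing R] [IsDomain R] [IsLocalRing R] [IsNoetherianRing R]
    (hdim : ringKrullDim R = 1)
    [Infinite (IsLocalRing.ResidueField R)]
    {K : Type u} [Field K] [Algebra R K] [IsFractionRing R K]
    [Module.Finite R (integralClosure R K)]
    [IsDiscreteValuationRing (integralClosure R K)]
    (hres : Function.Surjective
      (algebraMap R (IsLocalRing.ResidueField (integralClosure R K))))
    (ω : Submodule R K) (hω : BlowUp.IsCanonicalModule R 1 ω)
    (hRω : 1 ≤ ω) (hωR : ω ≤ BlowUp.Rbar R K)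
    (I : Ideal R) (hI : I.radical = IsLocalRing.maximalIdeal R)
    (hInp : ¬ Submodule.IsPrincipal I)
    (x : R) (hx : BlowUp.IsMinimalReduction I x) :
    let L : Subalgebra R K := BlowUp.blowup K I
    let Λ : Submodule R K := Subalgebra.toSubmodule L
    let ν : ℕ := BlowUp.reductionExponent I x
    let Iν : Submodule R K := BlowUp.idealPow K I ν
    let e : ℤ := BlowUp.multiplicity I
    let ρ : ℤ := BlowUp.genus I
    let δ : ℤ := ((BlowUp.deltaLength (⊥ : Subalgebra R K)).toNat : ℤ)
    let c : ℤ := ((BlowUp.condLength (⊥ : Subalgebra R K)).toNat : ℤ)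
    let cΛ : ℤ := ((BlowUp.condLength L).toNat : ℤ)
    -- all the invariants are well defined
    ((∀ n, BlowUp.hilbertLength I n ≠ ⊤) ∧
      BlowUp.IsHPolynomial I (BlowUp.hPolynomial I) ∧
      BlowUp.deltaLength (⊥ : Subalgebra R K) ≠ ⊤ ∧
      BlowUp.condLength (⊥ : Subalgebra R K) ≠ ⊤ ∧
      BlowUp.condLength L ≠ ⊤ ∧
      (Iν ≤ 1 / Λ ∧ BlowUp.quotLength (1 / Λ) Iν ≠ ⊤) ∧
      (Λ ≤ ω * Λ ∧ BlowUp.quotLength (ω * Λ) Λ ≠ ⊤)) ∧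
    2 * ρ = e * ν + (2 * δ - c) - ((BlowUp.quotLength (1 / Λ) Iν).toNat : ℤ)
      - ((BlowUp.quotLength (ω * Λ) Λ).toNat : ℤ) ∧
    2 * ρ ≤ e * ν + (2 * δ - c) ∧
    List.TFAE [
      2 * ρ = e * ν + (2 * δ - c),
      BlowUp.IsGorensteinLocalRing L ∧ c - cΛ = e * ν,
      1 / Λ = Iν ∧ ω * Λ = Λ,
      1 / Λ = Iν ∧ Iν ≤ 1 / ω] := by
  intro L Λ ν Iν e ρ δ c cΛ
  have hkd : Ring.KrullDimLE 1 R := Order.krullDimLE_iff _ _ |>.2 hdim.le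
  have hm : IsLocalRing.maximalIdeal R ≠ ⊥ := fun h => by
    rw [ringKrullDim_eq_zero_of_isField (IsLocalRing.isField_iff_maximalIdeal_eq.2 h)] at hdim
    exact zero_ne_one hdim
  have hI0 : I ≠ ⊥ := by
    rintro rfl
    refine hm (hI.symm.trans ?_)
    exact (Ideal.isPrime_bot (α := R)).isRadical.radical
  have hx0 := hx.ne_zero hI0
  have hxK : algebraMap R K x ≠ 0 := by simpa using hx0
  have hp : algebraMap R K x ^ ν ≠ 0 := pow_ne_zero ν hxK
  -- the lattices involved
  have l1 : BlowUp.IsLattice (1 : Submodule R K) := BlowUp.IsLattice.one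
  have lΛ : BlowUp.IsLattice Λ := BlowUp.isLattice_blowup hI0 hx
  have lI : BlowUp.IsLattice Iν := BlowUp.isLattice_idealPow hI0 ν
  have lω : BlowUp.IsLattice ω :=
    ⟨fun h => l1.ne_bot (le_bot_iff.1 (hRω.trans h.le)), Module.Finite.iff_fg.1 hω.finite⟩
  have lωΛ := lω.mul lΛ
  set V := BlowUp.Rbar R K with hV
  have lV : BlowUp.IsLattice V :=
    ⟨fun h => l1.ne_bot (le_bot_iff.1 ((hRω.trans hωR).trans h.le)),
      Module.Finite.iff_fg.1 (inferInstanceAs (Module.Finite R (integralClosure R K)))⟩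
  have hΛV : Λ ≤ V := fun z hz => by
    have : Module.Finite R L := Module.Finite.iff_fg.2 lΛ.fg
    have : Algebra.IsIntegral R L := Algebra.IsIntegral.of_finite R L
    exact (Algebra.IsIntegral.isIntegral (R := R) (⟨z, hz⟩ : L)).map L.val
  have h1Λ : 1 ≤ Λ := Submodule.one_le.2 L.one_mem
  have hΛΛ : Λ * Λ = Λ := L.isIdempotentElem_toSubmodule
  have hVV : V * V = V := (integralClosure R K).isIdempotentElem_toSubmodule
  have hmulV : ∀ M : Submodule R K, 1 ≤ M → M ≤ V → M * V = V := fun M h h' =>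
    le_antisymm ((mul_le_mul_left h' V).trans hVV.le) (by simpa using mul_le_mul_left h V)
  have hIΛ : Submodule.span R {algebraMap R K x ^ ν} * Λ = Iν :=
    BlowUp.span_pow_mul_blowup hx hx0
  have hI1 : Iν ≤ 1 := by
    rw [← BlowUp.idealPow_zero (K := K) I]
    exact BlowUp.idealPow_antitone I ν.zero_le
  have hIle : Iν ≤ 1 / Λ := by
    rw [Submodule.le_div_iff_mul_le, ← hIΛ, mul_assoc, hΛΛ, hIΛ]
    exact hI1
  have hΛω : Λ ≤ ω * Λ := by simpa using mul_le_mul_left hRω Λ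
  -- duality
  have ht := BlowUp.quotLength_div_maxSubmodule_le_one hm hω
  have hrefl : ∀ M : Submodule R K, BlowUp.IsLattice M → ω / (ω / M) = M := fun M hM =>
    BlowUp.div_div_cancel_of_type_one lω ht hM
  have hωω : ω / ω = 1 := by
    have := hrefl 1 l1
    rwa [BlowUp.div_one'] at this
  have hone : ∀ M : Submodule R K, 1 / M = ω / (ω * M) := fun M => by
    rw [BlowUp.div_mul_eq_div_div, hωω]
  -- `R̄` absorbs `ω` and `Λ` under multiplication, so the conductors of `R`, `ω` and `ω : Λ` into
  -- `R̄` coincide.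
  have h1V : 1 / V = ω / V := by rw [hone, hmulV ω hRω hωR]
  have hωΛV : (ω / Λ) / V = ω / V := by rw [← BlowUp.div_mul_eq_div_div, hmulV Λ h1Λ hΛV]
  -- all invariants in terms of degrees
  have hbot : Subalgebra.toSubmodule (⊥ : Subalgebra R K) = 1 := Algebra.toSubmodule_bot
  have le1V : 1 / V ≤ V := (BlowUp.div_le_div_left (hRω.trans hωR) 1).trans
    (by rw [BlowUp.div_one']; exact hRω.trans hωR)
  have leΛV : Λ / V ≤ V := (BlowUp.div_le_div_left (hRω.trans hωR) Λ).trans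
    (by rw [BlowUp.div_one']; exact hΛV)
  have eδ : δ = BlowUp.deg V := by
    have := BlowUp.toNat_quotLength lV l1 (hRω.trans hωR)
    rw [BlowUp.deg_one, sub_zero] at this
    simpa only [δ, BlowUp.deltaLength, hbot] using this
  have ec : c = BlowUp.deg V - BlowUp.deg (1 / V) := by
    simpa only [c, BlowUp.condLength, hbot] using
      BlowUp.toNat_quotLength lV (l1.div lV) le1V
  have ecΛ : cΛ = BlowUp.deg V - BlowUp.deg (Λ / V) :=
    BlowUp.toNat_quotLength lV (lΛ.div lV) leΛV
  have e1V : BlowUp.deg (1 / V) = BlowUp.deg ω - BlowUp.deg V := by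
    rw [h1V, BlowUp.deg_div lω ht lV]
  have e1Λ : BlowUp.deg (1 / Λ) = BlowUp.deg ω - BlowUp.deg (ω * Λ) := by
    rw [hone, BlowUp.deg_div lω ht lωΛ]
  have eρ : ρ = BlowUp.deg Λ := BlowUp.genus_eq_deg_blowup hI0 hx lΛ
  have eI : BlowUp.deg Iν = BlowUp.deg Λ - e * ν :=
    BlowUp.deg_idealPow_reductionExponent hI0 hx lΛ
  have q1 := BlowUp.toNat_quotLength (l1.div lΛ) lI hIle
  have q2 := BlowUp.toNat_quotLength lωΛ lΛ hΛω
  have hG := BlowUp.isGorensteinLocalRing_iff_exists_div_eq hm lΛ lω hrefl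
  -- `R : R̄ = (ω : Λ) : R̄ = y(Λ : R̄)`, so the conductor lengths differ by the shift due to `y`.
  have hcond : ∀ y : K, y ≠ 0 → ω / Λ = Submodule.span R {y} * Λ →
      c - cΛ = - BlowUp.deg (Submodule.span R {y}) := by
    intro y hy h
    have h1 : 1 / V = Submodule.span R {y} * (Λ / V) := by
      rw [h1V, ← hωΛV, h, BlowUp.span_singleton_mul_div hy]
    rw [ec, ecΛ, h1, BlowUp.deg_span_singleton_mul hy (lΛ.div lV)]
    ring
  refine ⟨⟨BlowUp.hilbertLength_ne_top hI0, BlowUp.isHPolynomial_hPolynomial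
    ⟨_, BlowUp.isHPolynomial_numerator K hI0 hx⟩, ?_, ?_, lV.quotLength_ne_top (lΛ.div lV),
    ⟨hIle, (l1.div lΛ).quotLength_ne_top lI⟩, ⟨hΛω, lωΛ.quotLength_ne_top lΛ⟩⟩, ?_, ?_, ?_⟩
  · rw [BlowUp.deltaLength, hbot]
    exact lV.quotLength_ne_top l1
  · rw [BlowUp.condLength, hbot]
    exact lV.quotLength_ne_top (l1.div lV)
  -- `q1` and `q2` add up to `deg ω + eν - 2 deg Λ`, where `deg ω = 2δ - c`.
  · lia
  · lia
  tfae_have 1 → 3 := by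
    intro h
    exact ⟨(BlowUp.eq_of_le_of_deg_le (l1.div lΛ) lI hIle (by lia)).symm,
      (BlowUp.eq_of_le_of_deg_le lωΛ lΛ hΛω (by lia)).symm⟩
  tfae_have 3 → 1 := by
    rintro ⟨h1, h2⟩
    rw [h1] at q1
    rw [h2] at q2
    lia
  tfae_have 3 → 4 := by
    rintro ⟨h1, h2⟩
    refine ⟨h1, ?_⟩
    rw [Submodule.le_div_iff_mul_le, ← hIΛ, mul_assoc, mul_comm Λ ω, h2, hIΛ]
    exact hI1
  tfae_have 4 → 3 := by
    rintro ⟨h1, h2⟩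
    refine ⟨h1, le_antisymm ?_ hΛω⟩
    rw [Submodule.le_div_iff_mul_le] at h2
    -- `xᵛωΛ·Λ = ωIᵛ ⊆ R`, so `xᵛωΛ ⊆ R : Λ = Iᵛ = xᵛΛ`, and `xᵛ` cancels.
    have h3 : Submodule.span R {algebraMap R K x ^ ν} * (ω * Λ) ≤ 1 / Λ := by
      rw [Submodule.le_div_iff_mul_le, mul_assoc, mul_assoc, hΛΛ, mul_comm ω, ← mul_assoc, hIΛ]
      exact h2
    rwa [h1, ← hIΛ, BlowUp.span_singleton_mul_le_iff hp, ← mul_assoc,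
      BlowUp.span_singleton_inv_mul_span_singleton R hp, one_mul] at h3
  tfae_have 3 → 2 := by
    rintro ⟨h1, h2⟩
    -- Here `y = xᵛ`: `ω : Λ = ω : ωΛ = R : Λ = Iᵛ = xᵛΛ`.
    have h3 : ω / Λ = Submodule.span R {algebraMap R K x ^ ν} * Λ := by
      rw [hIΛ, ← h1, hone, h2]
    refine ⟨hG.2 ⟨_, hp, h3⟩, ?_⟩
    rw [hcond _ hp h3]
    have := BlowUp.deg_span_singleton_mul hp lΛ
    rw [hIΛ] at this
    lia
  tfae_have 2 → 3 := by
    rintro ⟨h1, h2⟩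
    obtain ⟨y, hy, h3⟩ := hG.1 h1
    rw [hcond y hy h3] at h2
    have h4 := BlowUp.deg_span_singleton_mul hy lΛ
    rw [← h3] at h4
    have h5 : 1 / Λ ≤ ω / Λ := BlowUp.div_le_div_right hRω Λ
    -- The condition on `c - c_Λ` gives `ω : Λ = yΛ` the degree of `Iᵛ`. The chain `Iᵛ ⊆ R : Λ ⊆ ω :
    -- Λ` therefore collapses, and dualizing `ω : ωΛ = R : Λ = ω : Λ` yields `ωΛ = Λ`.
    have h6 : Iν = ω / Λ :=
      BlowUp.eq_of_le_of_deg_le (lω.div lΛ) lI (hIle.trans h5) (by lia)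
    have h7 : 1 / Λ = ω / Λ := le_antisymm h5 (h6 ▸ hIle)
    refine ⟨h7.trans h6.symm, ?_⟩
    rw [← hrefl _ lωΛ, ← hone, h7, hrefl _ lΛ]
  tfae_finish
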